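/- Let $n\ge 0$. A double wiring diagram consists of two families of $n$ lines, one light and one dark, running from left to right, such that any two lines of like colour cross exactly once. At the left end the dark lines are numbered $1,\dots,n$ from bottom to top and the light lines $n,\dots,1$ from bottom to top. The diagram is recorded (up to deformation) by the sequence, traced from left to right, of its crossings of lines of like colour, each given with its colour and its height; a crossing of height $h\in\{1,\dots,n-1\}$ exchanges the lines of its colour in the $h$-th and $(h+1)$-st positions from the bottom. A chamber of level $k$ ($1\le k\le n$) is a region between two consecutive crossings (of either colour) of height $k$, or to the left of the first or to the right of the last one (for $k=n$ there are no crossings, and the region above all lines is the only chamber). If $I$ and $J$ are the sets of the $k$ light lines and of the $k$ dark lines that pass below the chamber, then the minor $\Delta_{I,J}(x)$ of an $n\times n$ matrix $x$ with row set $I$ and column set $J$ is called the chamber minor of this chamber. **Theorem.** Let $D$ be a double wiring diagram with $n$ lines of each colour. Then $D$ has $n^2$ chambers, and distinct chambers have distinct pairs of sets $(I,J)$, so that $D$ has $n^2$ chamber minors $\Delta_1,\dots,\Delta_{n^2}$. Every minor of a generic $n\times n$ matrix is a subtraction-free rational expression in these chamber minors. Precisely: for all $I,J\subseteq\{1,\dots,n\}$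 with $|I|=|J|$ there are polynomials $P,Q$ in $n^2$ variables with nonnegative integer coefficients (that is, all coefficients that occur are positive integers) such that, for every field $K$ and the $n\times n$ matrix $x$ whose entries are $n^2$ independent indeterminates over $K$, $$Q(\Delta_1(x),\dots,\Delta_{n^2}(x))\neq 0\qquad\text{and}\qquad \Delta_{I,J}(x)=\frac{P(\Delta_1(x),\dots,\Delta_{n^2}(x))}{Q(\Delta_1(x),\dots,\Delta_{n^2}(x))}$$ in the field of rational functions over $K$ in the entries of $x$. -/

import Mathlib

/-- The two colours of a double wiring diagram. Light lines carry row indices and dark lines carry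
column indices. -/
inductive WireColor : Type
  | dark
  | light
deriving DecidableEq

/-- A crossing of two like-coloured lines that occupy neighbouring heights. Heights of lines are
counted from the bottom, starting at `0`; a crossing of height `h` exchanges the lines at the
heights `h` and `h + 1`. -/
structure WireCrossing (n : ℕ) : Type where
  color : WireColor
  height : Fin (n - 1)
deriving DecidableEq

namespace WireCrossing

variable {n : ℕ}

/-- The lower of the two heights that a crossing exchanges. -/
def lower (x : WireCrossing n) : Fin n := ⟨x.height.val, by omega⟩

/-- The upper of the two heights that a crossing exchanges. -/
def upper (x : WireCrossing n) : Fin n := ⟨x.height.val + 1, by omega⟩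

end WireCrossing

/-- The numbering of the lines at the left end of the diagram, as a map from heights to lines:
bottom to top, dark lines are numbered increasingly and light lines decreasingly. -/
def initialLines (n : ℕ) : WireColor → Equiv.Perm (Fin n)
  | WireColor.dark => 1
  | WireColor.light => Fin.revPerm

/-- The lines of colour `c` after the crossings in the list `w` (read left to right) have been
passed, as a map from heights to lines. -/
def linesAfter {n : ℕ} (c : WireColor) (w : List (WireCrossing n)) : Equiv.Perm (Fin n) :=
  w.foldl (fun σ x => if x.color = c then σ * Equiv.swap x.lower x.upper else σ) (initialLines n c)

/-- A double wiring diagram: two families of `n` lines, one dark and one light, recorded by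
the colours and heights of the crossings of lines of like colour, traced from left to right, such
that every two lines of like colour cross exactly once. -/
structure DoubleWiringDiagram (n : ℕ) : Type where
  word : List (WireCrossing n)
  crosses_once : ∀ (c : WireColor) (i j : Fin n), i ≠ j →
    ∃! t : Fin word.length, word[t].color = c ∧
      s(linesAfter c (word.take t) word[t].lower, linesAfter c (word.take t) word[t].upper) =
        s(i, j)

/-- The lines that occupy the lowest `k` heights, when `σ` maps heights to lines. -/
def linesBelow {n : ℕ} (σ : Equiv.Perm (Fin n)) (k : ℕ) : Finset (Fin n) :=
  (Finset.univ.filter fun p : Fin n => p.val < k).map σ.toEmbedding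

theorem card_linesBelow {n : ℕ} (σ : Equiv.Perm (Fin n)) {k : ℕ} (hk : k ≤ n) :
    (linesBelow σ k).card = k := by
  rw [linesBelow, Finset.card_map, Fin.card_filter_val_lt, min_eq_right hk]

/-- The minor of `x` with row set `I` and column set `J`, both of size `k`, their elements taken in
increasing order. -/
def matrixMinor {n : ℕ} {R : Type*} [CommRing R] (x : Matrix (Fin n) (Fin n) R) {k : ℕ}
    (I J : Finset (Fin n)) (hI : I.card = k) (hJ : J.card = k) : R :=
  (x.submatrix (I.orderEmbOfFin hI) (J.orderEmbOfFin hJ)).det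

namespace DoubleWiringDiagram

variable {n : ℕ} (D : DoubleWiringDiagram n)

/-- The chambers of a diagram, without the one that lies below all lines. A chamber of level `k`
has exactly `k` lines of each colour below it. It either extends to the left end of the diagram
(`Sum.inl`, one such chamber for each level `1, …, n`), or its left end is a crossing of height
`k - 1` of either colour (`Sum.inr`). -/
abbrev Chamber : Type := Fin n ⊕ Fin D.word.length

/-- The number of lines of each colour that pass below the chamber. -/
def level : D.Chamber → ℕ
  | Sum.inl k => k.val + 1
  | Sum.inr t => (D.word[t]).height.val + 1

/-- The number of crossings that lie to the left of the left end of the chamber, the crossing at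
this end included. -/
def start : D.Chamber → ℕ
  | Sum.inl _ => 0
  | Sum.inr t => t.val + 1

/-- The lines of colour `c` that pass below the chamber. -/
def below (c : WireColor) (C : D.Chamber) : Finset (Fin n) :=
  linesBelow (linesAfter c (D.word.take (D.start C))) (D.level C)

theorem level_le (C : D.Chamber) : D.level C ≤ n := by
  rcases C with k | t
  · exact k.isLt
  · have h := (D.word[t]).height.isLt
    show (D.word[t]).height.val + 1 ≤ n
    omega

theorem card_below (c : WireColor) (C : D.Chamber) : (D.below c C).card = D.level C :=
  card_linesBelow _ (D.level_le C)

/-- The chamber minor of `x`: its rows are the light lines below the chamber, its columns the dark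
lines below the chamber. -/
def chamberMinor {R : Type*} [CommRing R] (x : Matrix (Fin n) (Fin n) R) (C : D.Chamber) : R :=
  matrixMinor x (D.below WireColor.light C) (D.below WireColor.dark C)
    (D.card_below WireColor.light C) (D.card_below WireColor.dark C)

end DoubleWiringDiagram

/-- The generic `n × n` matrix over `K`: its entries are `n ^ 2` independent indeterminates, in the
field of rational functions in these indeterminates with coefficients in `K`. -/
noncomputable def genericMatrix (n : ℕ) (K : Type*) [Field K] :
    Matrix (Fin n) (Fin n) (FractionRing (MvPolynomial (Fin n × Fin n) K)) :=
  (Matrix.mvPolynomialX (Fin n) (Fin n) K).map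
    (algebraMap (MvPolynomial (Fin n × Fin n) K) (FractionRing (MvPolynomial (Fin n × Fin n) K)))

/-! Name the lines of each colour by their heights at the left end. A position in the diagram is
then a pair of permutations, starting at the identity pair. As any two like-coloured lines cross
exactly once, every crossing is an ascent and no ascent is left at the right end (`ascent_state`,
`not_ascent_state_length`). The diagram is thus a maximal chain of ascents, and its chamber minors
are the minors seen at the levels of the states on this chain.

Two chains that leave a state by different ascents can be rejoined by a commuting square or a braid
hexagon. Passing from one side to the other replaces at most one minor by another, and the product
of the old and the new one is a sum of two products of minors common to both sides. For crossings of
different colours at one height this is the Desnanot–Jacobi identity (`setMinor_dodgson`), for a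
braid a three-term flag relation (`setMinor_flag`). Both specialise one Grassmann–Plücker relation.
Generic minors are nonzero, so division gives the new minor without subtraction.

Induction on `weight` spreads this from the given chain to all states reachable from the left end
(`LocallyClosed.holds_of_reaches`). Every pair of permutations is reachable (`reaches_of_one`), and
every pair of sets of equal size lies below some level of some state.

For the count, crossings correspond to a colour and a pair of lines, so there are `n + 2 * n.choose
2 = n ^ 2` chambers. They are distinct because a crossing puts below its chamber the higher of two
lines without the lower one, which is impossible before they cross (`not_start_lt`). -/

/-- The determinant of the columns of `M` listed by `g`, in this order. -/
def columnDet {R C : Type*} [CommRing R] {N : ℕ} (M : Matrix (Fin N) C R) (g : Fin N → C) : R :=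
  (M.submatrix id g).det

/-! ### Three-term Grassmann–Plücker relation. -/

section GrassmannPluecker

variable {R C : Type*} [CommRing R]

theorem cramer_submatrix_apply {N : ℕ} (M : Matrix (Fin N) C R) (g : Fin N → C) (e : C)
    (k : Fin N) :
    Matrix.cramer (M.submatrix id g) (fun i => M i e) k = columnDet M (Function.update g k e) := by
  rw [Matrix.cramer_apply, columnDet]
  congr 1
  ext i j
  by_cases h : j = k
  · subst h; simp
  · simp [h]

theorem columnDet_eq_zero_of_not_injective {N : ℕ} (M : Matrix (Fin N) C R) (g : Fin N → C)
    {i j : Fin N} (hij : i ≠ j) (h : g i = g j) : columnDet M g = 0 :=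
  Matrix.det_zero_of_column_eq hij fun r => by simp [h]

theorem columnDet_cons_swap {m : ℕ} (M : Matrix (Fin (m + 2)) C R) (a b : C) (J : Fin m → C) :
    columnDet M (Fin.cons a (Fin.cons b J)) = -columnDet M (Fin.cons b (Fin.cons a J)) := by
  have h := Matrix.det_permute' (Equiv.swap (0 : Fin (m + 2)) 1)
    (M.submatrix id (Fin.cons b (Fin.cons a J) : Fin (m + 2) → C))
  rw [Equiv.Perm.sign_swap (by simp), Matrix.submatrix_submatrix] at h
  have hg : (Fin.cons b (Fin.cons a J) : Fin (m + 2) → C) ∘ Equiv.swap (0 : Fin (m + 2)) 1 =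
      Fin.cons a (Fin.cons b J) := by
    funext k
    refine Fin.cases ?_ (fun k => ?_) k
    · rw [Function.comp_apply, Equiv.swap_apply_left, ← Fin.succ_zero_eq_one]
      simp
    · refine Fin.cases ?_ (fun k => ?_) k
      · have : Fin.succ (0 : Fin (m + 1)) = (1 : Fin (m + 2)) := rfl
        rw [Function.comp_apply, this, Equiv.swap_apply_right, Fin.cons_zero, ← this]
        simp
      · have h1 : k.succ.succ ≠ (1 : Fin (m + 2)) := fun h =>
          Fin.succ_ne_zero k (Fin.succ_injective _ h)
        rw [Function.comp_apply, Equiv.swap_apply_of_ne_of_ne (Fin.succ_ne_zero _) h1]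
        simp
  rw [hg] at h
  simpa [columnDet] using h

/-- The three-term Grassmann–Plücker relation. -/
theorem grassmann_pluecker {m : ℕ} (M : Matrix (Fin (m + 2)) C R) (a b c e : C) (J : Fin m → C) :
    columnDet M (Fin.cons a (Fin.cons b J)) * columnDet M (Fin.cons e (Fin.cons c J)) =
      columnDet M (Fin.cons e (Fin.cons b J)) * columnDet M (Fin.cons a (Fin.cons c J)) +
      columnDet M (Fin.cons a (Fin.cons e J)) * columnDet M (Fin.cons b (Fin.cons c J)) := by
  set g : Fin (m + 2) → C := Fin.cons a (Fin.cons b J) with hg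
  have h1 := Matrix.mulVec_cramer (M.submatrix id g) (fun i => M i e)
  -- Cramer's rule writes `det g` times column `e` as a combination of the columns `g k`. Putting
  -- both sides into the first column of the determinant of `e, c, J` keeps the relation, by
  -- linearity.
  have h2 := congrArg (fun v => Matrix.cramer
    (M.submatrix id (Fin.cons e (Fin.cons c J) : Fin (m + 2) → C)) v 0) h1
  have h3 : (M.submatrix id g).mulVec
      ((M.submatrix id g).cramer fun i => M i e) =
      ∑ k, columnDet M (Function.update g k e) • fun i => M i (g k) := by
    funext i
    simp only [Matrix.mulVec, dotProduct, Finset.sum_apply, Pi.smul_apply, smul_eq_mul,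
      cramer_submatrix_apply]
    exact Finset.sum_congr rfl fun k _ => by rw [Matrix.submatrix_apply, id, mul_comm]
  simp only [h3, map_sum, map_smul, Finset.sum_apply, Pi.smul_apply, smul_eq_mul,
    cramer_submatrix_apply, Fin.update_cons_zero] at h2
  rw [Fin.sum_univ_succ, Fin.sum_univ_succ, Finset.sum_eq_zero, add_zero] at h2
  · rw [show (M.submatrix id g).det = columnDet M g from rfl] at h2
    rw [← h2]
    simp only [hg, Fin.update_cons_zero, ← Fin.cons_update, Fin.cons_zero, Fin.cons_succ]
  -- From the third term on, the inserted column is one of `J` and occurs twice.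
  · intro k _
    rw [columnDet_eq_zero_of_not_injective (i := 0) (j := k.succ.succ) M
      (Fin.cons (g k.succ.succ) (Fin.cons c J)) (Fin.succ_ne_zero _).symm (by simp [hg]), mul_zero]

end GrassmannPluecker

/-! ### Flag and Desnanot–Jacobi relations for unsorted minors. -/

section MinorRelations

variable {R C : Type*} [CommRing R] {n : Type*}

/-- A matrix augmented by the identity on the right. -/
def augmented {N : ℕ} (X : Matrix (Fin N) C R) : Matrix (Fin N) (C ⊕ Fin N) R :=
  Matrix.fromCols X 1

/-- Expansion along a unit column. Choosing a column of the identity block deletes a row, so minors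
of different sizes become maximal minors of one augmented matrix. -/
theorem columnDet_augmented_cons {N : ℕ} (X : Matrix (Fin (N + 1)) C R) (i : Fin (N + 1))
    (J : Fin N → C ⊕ Fin (N + 1)) :
    columnDet (augmented X) (Fin.cons (Sum.inr i) J) =
      (-1) ^ (i : ℕ) * ((augmented X).submatrix i.succAbove J).det := by
  rw [columnDet, Matrix.det_succ_column_zero, Finset.sum_eq_single i]
  · simp only [Matrix.submatrix_apply, id, Fin.cons_zero, augmented, Matrix.fromCols_apply_inr,
      Matrix.one_apply_eq, mul_one, Matrix.submatrix_submatrix]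
    rfl
  · intro k _ hk
    simp [augmented, hk]
  · simp

/-- The flag relation: two adjacent levels of the rows, three columns. -/
theorem det_flag_relation {m : ℕ} (X : Matrix n C R) (i : n) (I : Fin (m + 1) → n) (a b c : C)
    (J : Fin m → C) :
    (X.submatrix I (Fin.cons b J)).det *
        (X.submatrix (Fin.cons i I : Fin (m + 2) → n) (Fin.cons a (Fin.cons c J))).det =
      (X.submatrix I (Fin.cons a J)).det *
        (X.submatrix (Fin.cons i I : Fin (m + 2) → n) (Fin.cons b (Fin.cons c J))).det +
      (X.submatrix I (Fin.cons c J)).det *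
        (X.submatrix (Fin.cons i I : Fin (m + 2) → n) (Fin.cons a (Fin.cons b J))).det := by
  set Y : Matrix (Fin (m + 2)) C R := X.submatrix (Fin.cons i I : Fin (m + 2) → n) id with hY
  -- The unit column `0` deletes the row `i`; it occurs in exactly one factor of each product.
  have h := grassmann_pluecker (augmented Y) (Sum.inl a) (Sum.inl b) (Sum.inl c) (Sum.inr 0)
    (fun k => Sum.inl (J k))
  have hinl (p : C) (f : Fin m → C) : (Fin.cons (Sum.inl p) fun k => Sum.inl (f k) :
      Fin (m + 1) → C ⊕ Fin (m + 2)) =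
      fun k => Sum.inl ((Fin.cons p f : Fin (m + 1) → C) k) := by
    funext k; refine Fin.cases ?_ (fun k => ?_) k <;> simp
  have h2 (p q : C) : columnDet (augmented Y) (Fin.cons (Sum.inl p) (Fin.cons (Sum.inl q)
      fun k => Sum.inl (J k))) =
      (X.submatrix (Fin.cons i I : Fin (m + 2) → n) (Fin.cons p (Fin.cons q J))).det := by
    rw [columnDet]
    congr 1
    ext r k
    refine Fin.cases ?_ (fun k => ?_) k
    · simp [hY, augmented]
    · refine Fin.cases ?_ (fun k => ?_) k <;> simp [hY, augmented]
  have h1 (q : C) : columnDet (augmented Y) (Fin.cons (Sum.inr 0) (Fin.cons (Sum.inl q)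
      fun k => Sum.inl (J k))) = (X.submatrix I (Fin.cons q J)).det := by
    rw [columnDet_augmented_cons]
    simp only [Fin.val_zero, pow_zero, one_mul]
    congr 1
    ext r k
    refine Fin.cases ?_ (fun k => ?_) k <;> simp [hY, augmented]
  rw [columnDet_cons_swap (augmented Y) (Sum.inl a) (Sum.inr 0), h1, h1, h1, h2, h2, h2] at h
  linear_combination -h

/-- The Desnanot–Jacobi (Dodgson) identity. -/
theorem det_dodgson_relation {m : ℕ} (X : Matrix n C R) (i i' : n) (I : Fin m → n) (j j' : C)
    (J : Fin m → C) :
    (X.submatrix (Fin.cons i (Fin.cons i' I) : Fin (m + 2) → n)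
        (Fin.cons j (Fin.cons j' J))).det * (X.submatrix I J).det =
      (X.submatrix (Fin.cons i I : Fin (m + 1) → n) (Fin.cons j J)).det *
        (X.submatrix (Fin.cons i' I : Fin (m + 1) → n) (Fin.cons j' J)).det -
      (X.submatrix (Fin.cons i I : Fin (m + 1) → n) (Fin.cons j' J)).det *
        (X.submatrix (Fin.cons i' I : Fin (m + 1) → n) (Fin.cons j J)).det := by
  set Y : Matrix (Fin (m + 2)) C R :=
    X.submatrix (Fin.cons i (Fin.cons i' I) : Fin (m + 2) → n) id with hY
  -- The unit columns `0` and `1` delete the rows `i` and `i'`. Deleting row `1` alone costs the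
  -- sign in `h1'`.
  have h := grassmann_pluecker (augmented Y) (Sum.inl j) (Sum.inl j') (Sum.inr 1) (Sum.inr 0)
    (fun k => Sum.inl (J k))
  have h2 : columnDet (augmented Y) (Fin.cons (Sum.inl j) (Fin.cons (Sum.inl j')
      fun k => Sum.inl (J k))) =
      (X.submatrix (Fin.cons i (Fin.cons i' I) : Fin (m + 2) → n)
        (Fin.cons j (Fin.cons j' J))).det := by
    rw [columnDet]
    congr 1
    ext r k
    refine Fin.cases ?_ (fun k => ?_) k
    · simp [hY, augmented]
    · refine Fin.cases ?_ (fun k => ?_) k <;> simp [hY, augmented]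
  have h1 (q : C) : columnDet (augmented Y) (Fin.cons (Sum.inr 0) (Fin.cons (Sum.inl q)
      fun k => Sum.inl (J k))) =
      (X.submatrix (Fin.cons i' I : Fin (m + 1) → n) (Fin.cons q J)).det := by
    rw [columnDet_augmented_cons]
    simp only [Fin.val_zero, pow_zero, one_mul]
    congr 1
    ext r k
    refine Fin.cases ?_ (fun k => ?_) k <;> simp [hY, augmented]
  have h1' (q : C) : columnDet (augmented Y) (Fin.cons (Sum.inr 1) (Fin.cons (Sum.inl q)
      fun k => Sum.inl (J k))) =
      -(X.submatrix (Fin.cons i I : Fin (m + 1) → n) (Fin.cons q J)).det := by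
    rw [columnDet_augmented_cons]
    simp only [Fin.val_one, pow_one, neg_mul, one_mul]
    congr 2
    ext r k
    rw [← Fin.succ_zero_eq_one]
    refine Fin.cases ?_ (fun k => ?_) k <;> refine Fin.cases ?_ (fun r => ?_) r <;>
      simp [hY, augmented, -Fin.succ_zero_eq_one, -Fin.succ_zero_eq_one']
  have h0 : columnDet (augmented Y) (Fin.cons (Sum.inr 0) (Fin.cons (Sum.inr 1)
      fun k => Sum.inl (J k))) = (X.submatrix I J).det := by
    rw [columnDet_augmented_cons]
    simp only [Fin.val_zero, pow_zero, one_mul]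
    rw [Matrix.det_succ_column_zero, Finset.sum_eq_single 0]
    · simp only [Fin.succAbove_zero, Fin.val_zero, pow_zero, one_mul, Matrix.submatrix_apply,
        Fin.cons_zero, augmented, Matrix.fromCols_apply_inr, Fin.succ_zero_eq_one,
        Matrix.one_apply_eq]
      rfl
    · intro k _ hk
      have : k.succ ≠ (1 : Fin (m + 2)) := fun h => hk (Fin.succ_injective _ h)
      simp [augmented, this]
    · simp
  rw [columnDet_cons_swap (augmented Y) (Sum.inl j) (Sum.inr 0),
    columnDet_cons_swap (augmented Y) (Sum.inl j) (Sum.inr 1),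
    columnDet_cons_swap (augmented Y) (Sum.inl j') (Sum.inr 1), h0, h1, h1, h1', h1', h2] at h
  linear_combination h

end MinorRelations

/-! ### The same relations for minors indexed by sets, with signs removed. -/

section SortedMinors

variable {n : ℕ} {R : Type*} [CommRing R]

/-- The minor of `x` with row set `I` and column set `J`, or `0` if these differ in size. -/
def setMinor (x : Matrix (Fin n) (Fin n) R) (I J : Finset (Fin n)) : R :=
  if h : J.card = I.card then matrixMinor x I J rfl h else 0

theorem matrixMinor_eq_setMinor (x : Matrix (Fin n) (Fin n) R) {k : ℕ} (I J : Finset (Fin n))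
    (hI : I.card = k) (hJ : J.card = k) : matrixMinor x I J hI hJ = setMinor x I J := by
  subst hI
  rw [setMinor, dif_pos hJ]

/-- The sign of the permutation that sorts `i` into the sorted set `I`. -/
def insertSign (R : Type*) [CommRing R] (I : Finset (Fin n)) (i : Fin n) : R :=
  (-1) ^ (I.filter (· < i)).card

theorem insertSign_mul_self (I : Finset (Fin n)) (i : Fin n) :
    insertSign R I i * insertSign R I i = 1 := by
  rw [insertSign, ← mul_pow]; simp

theorem insertSign_insert_of_lt {I : Finset (Fin n)} {i i' : Fin n} (h : i < i') :
    insertSign R (insert i' I) i = insertSign R I i := by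
  rw [insertSign, insertSign, Finset.filter_insert, if_neg h.not_gt]

theorem card_filter_lt_orderEmbOfFin {k : ℕ} (I : Finset (Fin n)) (h : I.card = k) (p : Fin k) :
    (I.filter (· < I.orderEmbOfFin h p)).card = p := by
  have : I.filter (· < I.orderEmbOfFin h p) =
      (Finset.Iio p).map (I.orderEmbOfFin h).toEmbedding := by
    ext x
    simp only [Finset.mem_filter, Finset.mem_map, Finset.mem_Iio]
    constructor
    · rintro ⟨hx, hlt⟩
      have : x ∈ Set.range (I.orderEmbOfFin h) := by rw [Finset.range_orderEmbOfFin]; exact hx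
      obtain ⟨q, rfl⟩ := this
      exact ⟨q, (I.orderEmbOfFin h).lt_iff_lt.1 hlt, rfl⟩
    · rintro ⟨q, hq, rfl⟩
      exact ⟨Finset.orderEmbOfFin_mem _ _ _, (I.orderEmbOfFin h).lt_iff_lt.2 hq⟩
  rw [this, Finset.card_map, Fin.card_Iio]

theorem exists_sorting_perm {k : ℕ} {I : Finset (Fin n)} {i : Fin n}
    (hI : I.card = k) (hI' : (insert i I).card = k + 1) :
    ∃ π : Equiv.Perm (Fin (k + 1)), ((Equiv.Perm.sign π : ℤ) : R) = insertSign R I i ∧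
      (Fin.cons i (I.orderEmbOfFin hI) : Fin (k + 1) → Fin n) =
        (insert i I).orderEmbOfFin hI' ∘ π := by
  obtain ⟨p, hp⟩ : i ∈ Set.range ((insert i I).orderEmbOfFin hI') := by
    rw [Finset.range_orderEmbOfFin]; simp
  have hrem : (insert i I).orderEmbOfFin hI' ∘ p.succAbove = I.orderEmbOfFin hI := by
    refine Finset.orderEmbOfFin_unique hI (fun x => ?_)
      (((insert i I).orderEmbOfFin hI').strictMono.comp (Fin.strictMono_succAbove p))
    refine Finset.mem_of_mem_insert_of_ne (Finset.orderEmbOfFin_mem (insert i I) hI' _) ?_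
    exact fun h => Fin.succAbove_ne p x (((insert i I).orderEmbOfFin hI').injective (h.trans hp.symm))
  -- This cycle takes the head of the list to `p`, the place of `i` in the sorted list; its sign is
  -- `(-1) ^ p`, and `p` counts the elements of `I` below `i`.
  refine ⟨p.cycleRange.symm, ?_, ?_⟩
  · have hcard := card_filter_lt_orderEmbOfFin (insert i I) hI' p
    rw [hp, Finset.filter_insert, if_neg (lt_irrefl i)] at hcard
    rw [Equiv.Perm.sign_symm, Fin.sign_cycleRange, insertSign, hcard]
    simp
  · funext j
    rw [← Fin.insertNth_apply_cycleRange_symm p, ← hrem, Function.comp_apply]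
    conv_rhs => rw [← Fin.insertNth_self_removeNth (α := fun _ => Fin n) p
      ((insert i I).orderEmbOfFin hI'), hp]
    rfl

theorem det_row_cons {k : ℕ} (x : Matrix (Fin n) (Fin n) R) {I : Finset (Fin n)} {i : Fin n}
    (hI : I.card = k) (hI' : (insert i I).card = k + 1) (g : Fin (k + 1) → Fin n) :
    (x.submatrix (Fin.cons i (I.orderEmbOfFin hI) : Fin (k + 1) → Fin n) g).det =
      insertSign R I i * (x.submatrix ((insert i I).orderEmbOfFin hI') g).det := by
  obtain ⟨π, hs, hπ⟩ := exists_sorting_perm (R := R) hI hI'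
  rw [hπ, ← hs, ← Matrix.det_permute]
  rfl

theorem det_col_cons {k : ℕ} (x : Matrix (Fin n) (Fin n) R) {J : Finset (Fin n)} {j : Fin n}
    (hJ : J.card = k) (hJ' : (insert j J).card = k + 1) (f : Fin (k + 1) → Fin n) :
    (x.submatrix f (Fin.cons j (J.orderEmbOfFin hJ) : Fin (k + 1) → Fin n)).det =
      insertSign R J j * (x.submatrix f ((insert j J).orderEmbOfFin hJ')).det := by
  rw [← Matrix.det_transpose, ← Matrix.det_transpose (x.submatrix f _), Matrix.transpose_submatrix,
    Matrix.transpose_submatrix]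
  exact det_row_cons x.transpose hJ hJ' f

theorem det_row_cons_cons {k : ℕ} (x : Matrix (Fin n) (Fin n) R) {I : Finset (Fin n)}
    {i i' : Fin n} (hi' : i' ∉ I) (hlt : i < i') (hI : I.card = k)
    (hI' : (insert i (insert i' I)).card = k + 2) (g : Fin (k + 2) → Fin n) :
    (x.submatrix (Fin.cons i (Fin.cons i' (I.orderEmbOfFin hI)) : Fin (k + 2) → Fin n) g).det =
      insertSign R I i * insertSign R I i' *
        (x.submatrix ((insert i (insert i' I)).orderEmbOfFin hI') g).det := by
  have hc : (insert i' I).card = k + 1 := by rw [Finset.card_insert_of_notMem hi', hI]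
  obtain ⟨π, hs, hπ⟩ := exists_sorting_perm (R := R) hI hc
  obtain ⟨ρ, hs', hρ⟩ := exists_sorting_perm (R := R) hc hI'
  rw [insertSign_insert_of_lt hlt] at hs'
  -- First `i'` is sorted into `I` with the head `i` fixed, then `i` is sorted in. As `i < i'`, the
  -- presence of `i'` does not alter the sign of `i`.
  have hdec : (Fin.cons i (Fin.cons i' (I.orderEmbOfFin hI)) : Fin (k + 2) → Fin n) =
      (insert i (insert i' I)).orderEmbOfFin hI' ∘ ρ ∘ Equiv.Perm.decomposeFin.symm (0, π) := by
    rw [← Function.comp_assoc, ← hρ, hπ]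
    funext r
    refine Fin.cases ?_ (fun r => ?_) r <;> simp
  rw [hdec, ← hs, ← hs']
  have h := Matrix.det_permute (ρ * Equiv.Perm.decomposeFin.symm (0, π))
    (x.submatrix ((insert i (insert i' I)).orderEmbOfFin hI') g)
  rw [Equiv.Perm.sign_mul, Equiv.Perm.decomposeFin.symm_sign, if_pos rfl] at h
  rw [Matrix.submatrix_submatrix] at h
  simpa using h

theorem det_col_cons_cons {k : ℕ} (x : Matrix (Fin n) (Fin n) R) {J : Finset (Fin n)}
    {j j' : Fin n} (hj' : j' ∉ J) (hlt : j < j') (hJ : J.card = k)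
    (hJ' : (insert j (insert j' J)).card = k + 2) (f : Fin (k + 2) → Fin n) :
    (x.submatrix f (Fin.cons j (Fin.cons j' (J.orderEmbOfFin hJ)) : Fin (k + 2) → Fin n)).det =
      insertSign R J j * insertSign R J j' *
        (x.submatrix f ((insert j (insert j' J)).orderEmbOfFin hJ')).det := by
  rw [← Matrix.det_transpose, ← Matrix.det_transpose (x.submatrix f _), Matrix.transpose_submatrix,
    Matrix.transpose_submatrix]
  exact det_row_cons_cons x.transpose hj' hlt hJ hJ' f

theorem setMinor_eq {k : ℕ} (x : Matrix (Fin n) (Fin n) R) {I J : Finset (Fin n)}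
    (hI : I.card = k) (hJ : J.card = k) :
    setMinor x I J = (x.submatrix (I.orderEmbOfFin hI) (J.orderEmbOfFin hJ)).det :=
  (matrixMinor_eq_setMinor x I J hI hJ).symm

theorem setMinor_transpose (x : Matrix (Fin n) (Fin n) R) (I J : Finset (Fin n)) :
    setMinor x.transpose I J = setMinor x J I := by
  by_cases h : J.card = I.card
  · rw [setMinor_eq x.transpose rfl h, setMinor_eq x h rfl, ← Matrix.transpose_submatrix,
      Matrix.det_transpose]
  · rw [setMinor, dif_neg h, setMinor, dif_neg (Ne.symm h)]

theorem card_insert_insert {I : Finset (Fin n)} {i i' : Fin n} {m : ℕ} (hi : i ∉ I) (hi' : i' ∉ I)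
    (hne : i ≠ i') (hI : I.card = m) : (insert i (insert i' I)).card = m + 2 := by
  rw [Finset.card_insert_of_notMem (by simp [hi, hne]), Finset.card_insert_of_notMem hi', hI]

/-- Sorting gives all three products the same sign `s`, and `s * s = 1`. The orders `i < i'` and `j
< j'` decide which product stands alone on the left, so that the right side has only plus signs. -/
theorem setMinor_dodgson (x : Matrix (Fin n) (Fin n) R) {I J : Finset (Fin n)}
    (hIJ : J.card = I.card) {i i' j j' : Fin n} (hi : i ∉ I) (hi' : i' ∉ I) (hj : j ∉ J)
    (hj' : j' ∉ J) (hii : i < i') (hjj : j < j') :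
    setMinor x (insert i I) (insert j J) * setMinor x (insert i' I) (insert j' J) =
      setMinor x (insert i (insert i' I)) (insert j (insert j' J)) * setMinor x I J +
        setMinor x (insert i I) (insert j' J) * setMinor x (insert i' I) (insert j J) := by
  have h := det_dodgson_relation x i i' (I.orderEmbOfFin rfl) j j' (J.orderEmbOfFin hIJ)
  have c (p : Fin n) (hp : p ∉ I) : (insert p I).card = I.card + 1 :=
    Finset.card_insert_of_notMem hp
  have d (p : Fin n) (hp : p ∉ J) : (insert p J).card = I.card + 1 := by
    rw [Finset.card_insert_of_notMem hp, hIJ]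
  have cc := card_insert_insert hi hi' hii.ne rfl
  have dd := card_insert_insert hj hj' hjj.ne hIJ
  rw [det_row_cons_cons x hi' hii rfl cc, det_col_cons_cons x hj' hjj hIJ dd,
    det_row_cons x rfl (c i hi), det_row_cons x rfl (c i' hi'),
    det_row_cons x rfl (c i hi), det_row_cons x rfl (c i' hi'),
    det_col_cons x hIJ (d j hj), det_col_cons x hIJ (d j' hj'),
    det_col_cons x hIJ (d j hj), det_col_cons x hIJ (d j' hj'),
    ← setMinor_eq, ← setMinor_eq, ← setMinor_eq, ← setMinor_eq, ← setMinor_eq, ← setMinor_eq] at h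
  have e1 := insertSign_mul_self (R := R) I i
  have e2 := insertSign_mul_self (R := R) I i'
  have e3 := insertSign_mul_self (R := R) J j
  have e4 := insertSign_mul_self (R := R) J j'
  set s := insertSign R I i * insertSign R I i' * insertSign R J j * insertSign R J j' with hs
  have hss : s * s = 1 := by
    rw [hs]
    calc _ = (insertSign R I i * insertSign R I i) * (insertSign R I i' * insertSign R I i') *
        (insertSign R J j * insertSign R J j) * (insertSign R J j' * insertSign R J j') := by ring
      _ = 1 := by rw [e1, e2, e3, e4]; ring
  have key : s * (setMinor x (insert i I) (insert j J) * setMinor x (insert i' I) (insert j' J)) =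
      s * (setMinor x (insert i (insert i' I)) (insert j (insert j' J)) * setMinor x I J +
        setMinor x (insert i I) (insert j' J) * setMinor x (insert i' I) (insert j J)) := by
    rw [hs]; linear_combination -h
  calc _ = s * (s * (setMinor x (insert i I) (insert j J) *
        setMinor x (insert i' I) (insert j' J))) := by rw [← mul_assoc, hss, one_mul]
    _ = _ := by rw [key, ← mul_assoc, hss, one_mul]

theorem setMinor_flag (x : Matrix (Fin n) (Fin n) R) {I J : Finset (Fin n)}
    (hIJ : I.card = J.card + 1) {i a b c : Fin n} (hi : i ∉ I) (ha : a ∉ J) (hb : b ∉ J)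
    (hc : c ∉ J) (hab : a < b) (hbc : b < c) :
    setMinor x I (insert b J) * setMinor x (insert i I) (insert a (insert c J)) =
      setMinor x I (insert a J) * setMinor x (insert i I) (insert b (insert c J)) +
        setMinor x I (insert c J) * setMinor x (insert i I) (insert a (insert b J)) := by
  have h := det_flag_relation x i (I.orderEmbOfFin hIJ) a b c (J.orderEmbOfFin rfl)
  have d (p : Fin n) (hp : p ∉ J) : (insert p J).card = J.card + 1 :=
    Finset.card_insert_of_notMem hp
  have cc : (insert i I).card = J.card + 2 := by rw [Finset.card_insert_of_notMem hi, hIJ]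
  have dab := card_insert_insert ha hb hab.ne rfl
  have dac := card_insert_insert ha hc (hab.trans hbc).ne rfl
  have dbc := card_insert_insert hb hc hbc.ne rfl
  rw [det_row_cons x hIJ cc, det_row_cons x hIJ cc, det_row_cons x hIJ cc,
    det_col_cons x rfl (d a ha), det_col_cons x rfl (d b hb), det_col_cons x rfl (d c hc),
    det_col_cons_cons x hb hab rfl dab, det_col_cons_cons x hc hbc rfl dbc,
    det_col_cons_cons x hc (hab.trans hbc) rfl dac,
    ← setMinor_eq, ← setMinor_eq, ← setMinor_eq, ← setMinor_eq, ← setMinor_eq, ← setMinor_eq] at h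
  have e1 := insertSign_mul_self (R := R) I i
  have e2 := insertSign_mul_self (R := R) J a
  have e3 := insertSign_mul_self (R := R) J b
  have e4 := insertSign_mul_self (R := R) J c
  set s := insertSign R I i * insertSign R J a * insertSign R J b * insertSign R J c with hs
  have hss : s * s = 1 := by
    rw [hs]
    calc _ = (insertSign R I i * insertSign R I i) * (insertSign R J a * insertSign R J a) *
        (insertSign R J b * insertSign R J b) * (insertSign R J c * insertSign R J c) := by ring
      _ = 1 := by rw [e1, e2, e3, e4]; ring
  have key : s * (setMinor x I (insert b J) * setMinor x (insert i I) (insert a (insert c J))) =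
      s * (setMinor x I (insert a J) * setMinor x (insert i I) (insert b (insert c J)) +
        setMinor x I (insert c J) * setMinor x (insert i I) (insert a (insert b J))) := by
    rw [hs]; linear_combination h
  calc _ = s * (s * (setMinor x I (insert b J) *
        setMinor x (insert i I) (insert a (insert c J)))) := by rw [← mul_assoc, hss, one_mul]
    _ = _ := by rw [key, ← mul_assoc, hss, one_mul]

theorem setMinor_empty (x : Matrix (Fin n) (Fin n) R) : setMinor x ∅ ∅ = 1 := by
  rw [setMinor_eq x Finset.card_empty Finset.card_empty, Matrix.det_fin_zero]

theorem setMinor_map {S : Type*} [CommRing S] (f : R →+* S) (x : Matrix (Fin n) (Fin n) R)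
    (I J : Finset (Fin n)) : setMinor (x.map f) I J = f (setMinor x I J) := by
  by_cases h : J.card = I.card
  · rw [setMinor_eq _ rfl h, setMinor_eq _ rfl h, RingHom.map_det]
    rfl
  · rw [setMinor, dif_neg h, setMinor, dif_neg h, map_zero]

theorem setMinor_genericMatrix_ne_zero {K : Type*} [Field K] {I J : Finset (Fin n)}
    (h : J.card = I.card) : setMinor (genericMatrix n K) I J ≠ 0 := by
  have hmap : setMinor (genericMatrix n K) I J = algebraMap (MvPolynomial (Fin n × Fin n) K) _
      (setMinor (Matrix.mvPolynomialX (Fin n) (Fin n) K) I J) :=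
    setMinor_map (algebraMap (MvPolynomial (Fin n × Fin n) K) _) _ I J
  rw [hmap]
  refine (map_ne_zero_iff _ (IsFractionRing.injective _ _)).2 fun h0 => ?_
  -- Specialise to the partial permutation matrix whose `I`-`J` block is the identity; this works
  -- over every field.
  let y : Matrix (Fin n) (Fin n) K := Matrix.of fun p q =>
    if ∃ a, p = I.orderEmbOfFin rfl a ∧ q = J.orderEmbOfFin h a then 1 else 0
  have h1 := congrArg (MvPolynomial.eval fun p : Fin n × Fin n => y p.1 p.2) h0
  rw [← setMinor_map, map_zero, show (Matrix.mvPolynomialX (Fin n) (Fin n) K).map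
    (MvPolynomial.eval fun p : Fin n × Fin n => y p.1 p.2) = y from
      Matrix.mvPolynomialX_mapMatrix_eval y, setMinor_eq y rfl h] at h1
  have h2 : y.submatrix (I.orderEmbOfFin rfl) (J.orderEmbOfFin h) = 1 := by
    ext p q
    simp [y, Matrix.one_apply, eq_comm]
  rw [h2, Matrix.det_one] at h1
  exact one_ne_zero h1

end SortedMinors

/-! ### States, ascents and local moves. -/

/-- The lines of both colours at a position of a diagram, as maps from heights to lines, where the
lines of each colour are named by their heights at the left end. -/
abbrev WireState (n : ℕ) : Type := WireColor → Equiv.Perm (Fin n)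

namespace WireState

variable {n : ℕ}

/-- The state after one more crossing. -/
def cross (u : WireState n) (x : WireCrossing n) : WireState n :=
  fun c => if x.color = c then u c * Equiv.swap x.lower x.upper else u c

/-- The two lines that `x` exchanges have not crossed yet. -/
def Ascent (u : WireState n) (x : WireCrossing n) : Prop :=
  u x.color x.lower < u x.color x.upper

theorem cross_of_eq (u : WireState n) {x : WireCrossing n} {c : WireColor} (h : x.color = c) :
    u.cross x c = u c * Equiv.swap x.lower x.upper := if_pos h

theorem cross_of_ne (u : WireState n) {x : WireCrossing n} {c : WireColor} (h : x.color ≠ c) :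
    u.cross x c = u c := if_neg h

theorem cross_cross (u : WireState n) (x : WireCrossing n) : (u.cross x).cross x = u := by
  funext c
  by_cases h : x.color = c
  · rw [cross_of_eq _ h, cross_of_eq _ h, mul_assoc, Equiv.swap_mul_self, mul_one]
  · rw [cross_of_ne _ h, cross_of_ne _ h]

theorem lower_lt_upper (x : WireCrossing n) : x.lower < x.upper :=
  Fin.lt_def.2 (Nat.lt_succ_self _)

/-- Crossings of different colours, or with disjoint pairs of heights. -/
def Far (x y : WireCrossing n) : Prop :=
  x.color ≠ y.color ∨ (x.lower ≠ y.lower ∧ x.lower ≠ y.upper ∧ x.upper ≠ y.lower)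

theorem Far.upper_ne {x y : WireCrossing n} (h : x.lower ≠ y.lower) : x.upper ≠ y.upper := by
  intro he
  apply h
  simp only [WireCrossing.upper, WireCrossing.lower, Fin.mk.injEq] at he ⊢
  omega

theorem Far.symm {x y : WireCrossing n} (h : Far x y) : Far y x := by
  rcases h with h | ⟨h1, h2, h3⟩
  · exact Or.inl h.symm
  · exact Or.inr ⟨h1.symm, h3.symm, h2.symm⟩

theorem Far.cross_comm {x y : WireCrossing n} (h : Far x y) (u : WireState n) :
    (u.cross x).cross y = (u.cross y).cross x := by
  funext c
  by_cases hx : x.color = c <;> by_cases hy : y.color = c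
  · rcases h with h | ⟨h1, h2, h3⟩
    · exact absurd (hx.trans hy.symm) h
    · rw [cross_of_eq _ hy, cross_of_eq _ hx, cross_of_eq _ hx, cross_of_eq _ hy, mul_assoc,
        mul_assoc]
      congr 1
      refine (Equiv.Perm.Disjoint.commute ?_).eq
      intro p
      by_cases hp : p = x.lower ∨ p = x.upper
      · right
        rcases hp with rfl | rfl
        · exact Equiv.swap_apply_of_ne_of_ne h1 h2
        · exact Equiv.swap_apply_of_ne_of_ne h3 (Far.upper_ne h1)
      · left
        push Not at hp
        exact Equiv.swap_apply_of_ne_of_ne hp.1 hp.2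
  · rw [cross_of_ne _ hy, cross_of_eq _ hx, cross_of_eq _ hx, cross_of_ne _ hy]
  · rw [cross_of_eq _ hy, cross_of_ne _ hx, cross_of_ne _ hx, cross_of_eq _ hy]
  · rw [cross_of_ne _ hy, cross_of_ne _ hx, cross_of_ne _ hx, cross_of_ne _ hy]

theorem Far.ascent {x y : WireCrossing n} (h : Far x y) {u : WireState n} (hy : Ascent u y) :
    Ascent (u.cross x) y := by
  rcases h with h | ⟨h1, h2, h3⟩
  · rw [Ascent, cross_of_ne _ h]; exact hy
  · by_cases hc : x.color = y.color
    · rw [Ascent, cross_of_eq _ hc, Equiv.Perm.mul_apply, Equiv.Perm.mul_apply,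
        Equiv.swap_apply_of_ne_of_ne h1.symm h3.symm,
        Equiv.swap_apply_of_ne_of_ne h2.symm (Far.upper_ne h1).symm]
      exact hy
    · rw [Ascent, cross_of_ne _ hc]; exact hy

/-- Crossings of the same colour at neighbouring heights, the first one below the second. -/
def Near (x y : WireCrossing n) : Prop := x.color = y.color ∧ x.upper = y.lower

theorem eq_or_far_or_near (x y : WireCrossing n) : x = y ∨ Far x y ∨ Near x y ∨ Near y x := by
  obtain ⟨c, h⟩ := x
  obtain ⟨d, k⟩ := y
  by_cases hc : c = d
  · subst hc
    simp only [Far, Near, WireCrossing.upper, WireCrossing.lower, WireCrossing.mk.injEq,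
      Fin.ext_iff, true_and, ne_eq, not_true, false_or]
    omega
  · exact Or.inr (Or.inl (Or.inl hc))

theorem Near.lower_ne {x y : WireCrossing n} (h : Near x y) : x.lower ≠ x.upper ∧
    x.lower ≠ y.upper ∧ x.upper ≠ y.upper := by
  have h1 := lower_lt_upper x
  have h2 := lower_lt_upper y
  rw [← h.2] at h2
  exact ⟨h1.ne, (h1.trans h2).ne, h2.ne⟩

theorem Near.braid {x y : WireCrossing n} (h : Near x y) (u : WireState n) :
    ((u.cross x).cross y).cross x = ((u.cross y).cross x).cross y := by
  funext c
  obtain ⟨h1, h2, h3⟩ := h.lower_ne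
  by_cases hx : x.color = c
  · have hy : y.color = c := h.1.symm.trans hx
    simp only [cross_of_eq _ hx, cross_of_eq _ hy, mul_assoc, ← h.2]
    congr 1
    rw [← mul_assoc, ← mul_assoc, Equiv.swap_mul_swap_mul_swap h1 h2, Equiv.swap_comm x.lower,
      Equiv.swap_comm x.upper y.upper, Equiv.swap_mul_swap_mul_swap h3.symm h2.symm]
    exact Equiv.swap_comm _ _
  · have hy : y.color ≠ c := fun hy => hx (h.1.trans hy)
    simp only [cross_of_ne _ hx, cross_of_ne _ hy]

/-- A function that decreases along ascents. -/
def weight (u : WireState n) : ℕ :=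
  ∑ p : Fin n, p.val * (u WireColor.dark p).val + ∑ p : Fin n, p.val * (u WireColor.light p).val

/-- Rearrangement inequality: the difference of the two sums is `(q - p) * (σ q - σ p)`. -/
theorem sum_mul_swap_lt (σ : Equiv.Perm (Fin n)) {p q : Fin n} (hpq : p < q) (h : σ p < σ q) :
    ∑ r : Fin n, r.val * ((σ * Equiv.swap p q) r).val < ∑ r : Fin n, r.val * (σ r).val := by
  have h1 : ∑ r : Fin n, r.val * ((σ * Equiv.swap p q) r).val =
      ∑ r : Fin n, (Equiv.swap p q r).val * (σ r).val := by
    rw [← Equiv.sum_comp (Equiv.swap p q)]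
    exact Finset.sum_congr rfl fun r _ => by simp
  rw [h1]
  zify
  rw [← sub_pos, ← Finset.sum_sub_distrib, Fintype.sum_eq_add p q hpq.ne]
  · rw [Equiv.swap_apply_left, Equiv.swap_apply_right]
    have h2 : (p.val : ℤ) < q.val := by exact_mod_cast hpq
    have h3 : ((σ p).val : ℤ) < (σ q).val := by exact_mod_cast h
    nlinarith [mul_pos (sub_pos.2 h2) (sub_pos.2 h3)]
  · rintro r ⟨hr1, hr2⟩
    rw [Equiv.swap_apply_of_ne_of_ne hr1 hr2, sub_self]

theorem Ascent.weight_lt {u : WireState n} {x : WireCrossing n} (h : Ascent u x) :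
    (u.cross x).weight < u.weight := by
  have hs := sum_mul_swap_lt (u x.color) (lower_lt_upper x) h
  obtain ⟨c, k⟩ := x
  cases c
  · rw [weight, weight, cross_of_eq _ rfl, cross_of_ne _ (c := WireColor.light) (by simp)]
    exact Nat.add_lt_add_right hs _
  · rw [weight, weight, cross_of_eq _ rfl, cross_of_ne _ (c := WireColor.dark) (by simp)]
    exact Nat.add_lt_add_left hs _

theorem weight_le (u : WireState n) : u.weight ≤ 2 * (n * (n * n)) := by
  have h (σ : Equiv.Perm (Fin n)) : ∑ p : Fin n, p.val * (σ p).val ≤ n * (n * n) := by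
    calc _ ≤ ∑ _p : Fin n, n * n :=
          Finset.sum_le_sum fun p _ => Nat.mul_le_mul p.isLt.le (σ p).isLt.le
      _ = _ := by simp
  have h1 := h (u WireColor.dark)
  have h2 := h (u WireColor.light)
  rw [weight]
  omega

/-- There is a path of ascents from `u`, maximal to the right, all of whose states satisfy `G`. -/
inductive MaximalPath (G : WireState n → Prop) : WireState n → Prop
  | last {u : WireState n} : G u → (∀ x, ¬ Ascent u x) → MaximalPath G u
  | step {u : WireState n} (x : WireCrossing n) : G u → Ascent u x → MaximalPath G (u.cross x) →
      MaximalPath G u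

/-- Reachability by ascents. -/
def Reaches : WireState n → WireState n → Prop :=
  Relation.ReflTransGen fun u v => ∃ x, Ascent u x ∧ v = u.cross x

theorem Ascent.reaches {u v : WireState n} {x : WireCrossing n} (h : Ascent u x)
    (hv : Reaches (u.cross x) v) : Reaches u v :=
  Relation.ReflTransGen.head ⟨x, h, rfl⟩ hv

theorem maximalPath_of_forall_reaches {G : WireState n → Prop} (u : WireState n)
    (h : ∀ v, Reaches u v → G v) : MaximalPath G u := by
  by_cases hx : ∃ x, Ascent u x
  · obtain ⟨x, hx⟩ := hx
    exact .step x (h u .refl) hx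
      (maximalPath_of_forall_reaches (u.cross x) fun v hv => h v (hx.reaches hv))
  · exact .last (h u .refl) fun x hx' => hx ⟨x, hx'⟩
termination_by u.weight
decreasing_by exact hx.weight_lt

theorem MaximalPath.holds {G : WireState n → Prop} {u : WireState n} (h : MaximalPath G u) :
    G u := by
  cases h <;> assumption

/-- The three lines involved stand in increasing order, so either half of the braid hexagon reverses
them by ascents only. -/
theorem Near.ascents_left {x y : WireCrossing n} (h : Near x y) {u : WireState n}
    (hx : Ascent u x) (hy : Ascent u y) :
    Ascent (u.cross x) y ∧ Ascent ((u.cross x).cross y) x := by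
  obtain ⟨h1, h2, h3⟩ := h.lower_ne
  rw [Ascent, h.1] at hx
  rw [Ascent, ← h.2] at hy
  constructor
  · rw [Ascent, cross_of_eq _ h.1, Equiv.Perm.mul_apply, Equiv.Perm.mul_apply, ← h.2,
      Equiv.swap_apply_right, Equiv.swap_apply_of_ne_of_ne h2.symm h3.symm]
    exact hx.trans hy
  · rw [Ascent, h.1, cross_of_eq _ rfl, cross_of_eq _ h.1, ← h.2]
    simp only [Equiv.Perm.mul_apply]
    rw [Equiv.swap_apply_of_ne_of_ne h1 h2, Equiv.swap_apply_left, Equiv.swap_apply_left,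
      Equiv.swap_apply_of_ne_of_ne h2.symm h3.symm]
    exact hy

theorem Near.ascents_right {x y : WireCrossing n} (h : Near x y) {u : WireState n}
    (hx : Ascent u x) (hy : Ascent u y) :
    Ascent (u.cross y) x ∧ Ascent ((u.cross y).cross x) y := by
  obtain ⟨h1, h2, h3⟩ := h.lower_ne
  rw [Ascent] at hx
  rw [Ascent, ← h.2, ← h.1] at hy
  constructor
  · rw [Ascent, cross_of_eq _ h.1.symm, Equiv.Perm.mul_apply, Equiv.Perm.mul_apply, ← h.2,
      Equiv.swap_apply_left, Equiv.swap_apply_of_ne_of_ne h1 h2]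
    exact hx.trans hy
  · rw [Ascent, ← h.1, cross_of_eq _ rfl, cross_of_eq _ h.1.symm, ← h.2]
    simp only [Equiv.Perm.mul_apply]
    rw [Equiv.swap_apply_right, Equiv.swap_apply_of_ne_of_ne h1 h2,
      Equiv.swap_apply_of_ne_of_ne h2.symm h3.symm, Equiv.swap_apply_right]
    exact hx

/-- A property of states that can be carried over local moves of diagrams. -/
structure LocallyClosed (G : WireState n → Prop) : Prop where
  far : ∀ u x y, Far x y → Ascent u x → Ascent u y → G u → G (u.cross x) →
    G ((u.cross x).cross y) → G (u.cross y)
  near : ∀ u x y, Near x y → Ascent u x → Ascent u y → G u → G (u.cross x) →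
    G ((u.cross x).cross y) → G (((u.cross x).cross y).cross x) →
      G (u.cross y) ∧ G ((u.cross y).cross x)
  near' : ∀ u x y, Near x y → Ascent u x → Ascent u y → G u → G (u.cross y) →
    G ((u.cross y).cross x) → G (((u.cross y).cross x).cross y) →
      G (u.cross x) ∧ G ((u.cross x).cross y)

/-- A locally closed property that holds along one maximal path holds at all reachable states. -/
theorem LocallyClosed.holds_of_reaches {G : WireState n → Prop} (hG : LocallyClosed G)
    (u v : WireState n) (hu : MaximalPath G u) (hv : Reaches u v) : G v := by
  rcases Relation.ReflTransGen.cases_head hv with rfl | ⟨w, ⟨y, hy, rfl⟩, hwv⟩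
  · exact hu.holds
  cases hu with
  | last _ h => exact absurd hy (h y)
  | step x hGu hx hpath =>
    -- Everything reachable through `x` satisfies `G`. It remains to build a maximal path from
    -- `u.cross y`: follow the other side of the square or hexagon, where local closedness gives
    -- `G`. From the meeting point on, all states are reachable through `x`.
    have ih := fun w hw => hG.holds_of_reaches (u.cross x) w hpath hw
    refine hG.holds_of_reaches (u.cross y) v ?_ hwv
    rcases eq_or_far_or_near x y with rfl | h | h | h
    · exact hpath
    · have hxy := h.ascent hy
      refine .step x (hG.far u x y h hx hy hGu hpath.holds (ih _ (hxy.reaches .refl)))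
        (h.symm.ascent hx) ?_
      rw [← h.cross_comm]
      exact maximalPath_of_forall_reaches _ fun w hw => ih w (hxy.reaches hw)
    · obtain ⟨a1, a2⟩ := h.ascents_left hx hy
      obtain ⟨b1, b2⟩ := h.ascents_right hx hy
      obtain ⟨g1, g2⟩ := hG.near u x y h hx hy hGu hpath.holds (ih _ (a1.reaches .refl))
        (ih _ (a1.reaches (a2.reaches .refl)))
      refine .step x g1 b1 (.step y g2 b2 ?_)
      rw [← h.braid]
      exact maximalPath_of_forall_reaches _ fun w hw => ih w (a1.reaches (a2.reaches hw))
    · obtain ⟨a1, a2⟩ := h.ascents_left hy hx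
      obtain ⟨b1, b2⟩ := h.ascents_right hy hx
      obtain ⟨g1, g2⟩ := hG.near' u y x h hy hx hGu hpath.holds (ih _ (b1.reaches .refl))
        (ih _ (b1.reaches (b2.reaches .refl)))
      refine .step x g1 a1 (.step y g2 a2 ?_)
      rw [h.braid]
      exact maximalPath_of_forall_reaches _ fun w hw => ih w (b1.reaches (b2.reaches hw))
termination_by u.weight
decreasing_by
  · exact hx.weight_lt
  · exact hy.weight_lt

/-- Every state is reachable from the left end. -/
theorem reaches_of_one (u : WireState n) : Reaches 1 u := by
  by_cases h : ∃ x, Ascent (u.cross x) x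
  · obtain ⟨x, hx⟩ := h
    have hlt : u.weight < (u.cross x).weight := by
      simpa only [cross_cross] using hx.weight_lt
    have hle := (u.cross x).weight_le
    refine (reaches_of_one (u.cross x)).tail ⟨x, hx, (cross_cross u x).symm⟩
  -- Without a descent both permutations increase, hence are the identity.
  · push Not at h
    suffices u = 1 by rw [this]; exact .refl
    funext c
    have hmono : StrictMono (u c) := by
      obtain _ | n := n
      · exact fun p => p.elim0
      refine Fin.strictMono_iff_lt_succ.2 fun p => ?_
      have hp := h ⟨c, p⟩
      rw [Ascent, cross_of_eq _ rfl, Equiv.Perm.mul_apply, Equiv.Perm.mul_apply,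
        Equiv.swap_apply_left, Equiv.swap_apply_right, not_lt] at hp
      exact lt_of_le_of_ne hp ((u c).injective.ne (lower_lt_upper (⟨c, p⟩ : WireCrossing (n + 1))).ne)
    have := Subsingleton.elim (hmono.orderIsoOfSurjective _ (u c).surjective)
      (OrderIso.refl (Fin n))
    ext p
    exact congrArg (fun e : Fin n ≃o Fin n => (e p).val) this
termination_by 2 * (n * (n * n)) - u.weight
decreasing_by omega

end WireState

/-! ### Sets of lines below a level. -/

section LinesBelow

variable {n : ℕ}

theorem apply_mem_linesBelow (σ : Equiv.Perm (Fin n)) (p : Fin n) (k : ℕ) :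
    σ p ∈ linesBelow σ k ↔ p.val < k := by
  simp [linesBelow]

/-- Both exchanged heights are below `k` or neither is; a crossing therefore affects a single level.
-/
theorem linesBelow_mul_swap (σ : Equiv.Perm (Fin n)) (x : WireCrossing n) {k : ℕ}
    (hk : k ≠ x.height.val + 1) :
    linesBelow (σ * Equiv.swap x.lower x.upper) k = linesBelow σ k := by
  ext i
  obtain ⟨p, rfl⟩ := σ.surjective i
  rw [apply_mem_linesBelow]
  have h : σ p = (σ * Equiv.swap x.lower x.upper) (Equiv.swap x.lower x.upper p) := by simp
  rw [h, apply_mem_linesBelow]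
  have hl : x.lower.val = x.height.val := rfl
  have hu : x.upper.val = x.height.val + 1 := rfl
  by_cases h1 : p = x.lower
  · rw [h1, Equiv.swap_apply_left]; omega
  · by_cases h2 : p = x.upper
    · rw [h2, Equiv.swap_apply_right]; omega
    · rw [Equiv.swap_apply_of_ne_of_ne h1 h2]

theorem linesBelow_succ (σ : Equiv.Perm (Fin n)) (p : Fin n) :
    linesBelow σ (p.val + 1) = insert (σ p) (linesBelow σ p.val) := by
  ext i
  obtain ⟨q, rfl⟩ := σ.surjective i
  rw [apply_mem_linesBelow, Finset.mem_insert, apply_mem_linesBelow, σ.injective.eq_iff,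
    Fin.ext_iff]
  omega

end LinesBelow

/-! ### Exchange relations imply local closedness. -/

namespace WireState

variable {n : ℕ}

/-- The line of colour `c` at height `p`. -/
def line (u : WireState n) (c : WireColor) (p : Fin n) : Fin n := initialLines n c (u c p)

/-- The lines of colour `c` at the lowest `k` heights. -/
def lineSet (u : WireState n) (c : WireColor) (k : ℕ) : Finset (Fin n) :=
  linesBelow (initialLines n c * u c) k

theorem card_lineSet (u : WireState n) (c : WireColor) {k : ℕ} (hk : k ≤ n) :
    (u.lineSet c k).card = k := card_linesBelow _ hk

theorem line_mem_lineSet (u : WireState n) (c : WireColor) (p : Fin n) (k : ℕ) :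
    u.line c p ∈ u.lineSet c k ↔ p.val < k :=
  apply_mem_linesBelow (initialLines n c * u c) p k

theorem lineSet_cross_of_ne (u : WireState n) (x : WireCrossing n) (c : WireColor) {k : ℕ}
    (hk : k ≠ x.height.val + 1) : (u.cross x).lineSet c k = u.lineSet c k := by
  by_cases h : x.color = c
  · rw [lineSet, cross_of_eq _ h, ← mul_assoc, linesBelow_mul_swap _ _ hk, lineSet]
  · rw [lineSet, cross_of_ne _ h, lineSet]

theorem lineSet_cross_of_color_ne (u : WireState n) {x : WireCrossing n} {c : WireColor}
    (h : x.color ≠ c) (k : ℕ) : (u.cross x).lineSet c k = u.lineSet c k := by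
  rw [lineSet, cross_of_ne _ h, lineSet]

theorem lineSet_succ (u : WireState n) (c : WireColor) (p : Fin n) :
    u.lineSet c (p.val + 1) = insert (u.line c p) (u.lineSet c p.val) :=
  linesBelow_succ (initialLines n c * u c) p

theorem lineSet_height_succ (u : WireState n) (x : WireCrossing n) (c : WireColor) :
    u.lineSet c (x.height.val + 1) = insert (u.line c x.lower) (u.lineSet c x.height.val) :=
  u.lineSet_succ c x.lower

theorem lineSet_height_succ_succ (u : WireState n) (x : WireCrossing n) (c : WireColor) :
    u.lineSet c (x.height.val + 2) =
      insert (u.line c x.upper) (insert (u.line c x.lower) (u.lineSet c x.height.val)) := by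
  rw [← lineSet_height_succ]
  exact u.lineSet_succ c x.upper

theorem line_cross_lower (u : WireState n) {x : WireCrossing n} {c : WireColor}
    (h : x.color = c) : (u.cross x).line c x.lower = u.line c x.upper := by
  rw [line, cross_of_eq _ h, Equiv.Perm.mul_apply, Equiv.swap_apply_left, line]

theorem line_cross_upper (u : WireState n) {x : WireCrossing n} {c : WireColor}
    (h : x.color = c) : (u.cross x).line c x.upper = u.line c x.lower := by
  rw [line, cross_of_eq _ h, Equiv.Perm.mul_apply, Equiv.swap_apply_right, line]

theorem line_cross_of_ne (u : WireState n) (x : WireCrossing n) (c : WireColor) {p : Fin n}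
    (h1 : p ≠ x.lower) (h2 : p ≠ x.upper) : (u.cross x).line c p = u.line c p := by
  by_cases h : x.color = c
  · rw [line, cross_of_eq _ h, Equiv.Perm.mul_apply, Equiv.swap_apply_of_ne_of_ne h1 h2, line]
  · rw [line, cross_of_ne _ h, line]

theorem lineSet_cross_self (u : WireState n) {x : WireCrossing n} {c : WireColor}
    (h : x.color = c) : (u.cross x).lineSet c (x.height.val + 1) =
      insert (u.line c x.upper) (u.lineSet c x.height.val) := by
  rw [lineSet_height_succ, line_cross_lower _ h, lineSet_cross_of_ne _ _ _ (by omega)]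

theorem line_dark_lt (u : WireState n) {p q : Fin n} (h : u WireColor.dark p < u WireColor.dark q) :
    u.line WireColor.dark p < u.line WireColor.dark q := h

/-- Light lines are numbered downwards at the left end. This reversal is what puts the two mixed
minors of a two-coloured move on the single-product side of the Desnanot–Jacobi identity. -/
theorem line_light_lt (u : WireState n) {p q : Fin n}
    (h : u WireColor.light p < u WireColor.light q) :
    u.line WireColor.light q < u.line WireColor.light p := Fin.rev_lt_rev.2 h

/-- A property of pairs of sets (of rows and of columns) that can be carried over the three-term
relations between minors. -/
structure ExchangeClosed (F : Finset (Fin n) → Finset (Fin n) → Prop) : Prop where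
  dodgson : ∀ {I J : Finset (Fin n)} {i i' j j' : Fin n}, J.card = I.card → i ∉ I → i' ∉ I →
    j ∉ J → j' ∉ J → i < i' → j < j' → F (insert i (insert i' I)) (insert j (insert j' J)) →
    F I J → F (insert i I) (insert j' J) → F (insert i' I) (insert j J) →
    (F (insert i I) (insert j J) ↔ F (insert i' I) (insert j' J))
  flag_col : ∀ {I J : Finset (Fin n)} {i a b c : Fin n}, I.card = J.card + 1 → i ∉ I → a ∉ J →
    b ∉ J → c ∉ J → a < b → b < c → F I (insert a J) → F (insert i I) (insert b (insert c J)) →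
    F I (insert c J) → F (insert i I) (insert a (insert b J)) →
    (F I (insert b J) ↔ F (insert i I) (insert a (insert c J)))
  flag_row : ∀ {I J : Finset (Fin n)} {i a b c : Fin n}, I.card = J.card + 1 → i ∉ I → a ∉ J →
    b ∉ J → c ∉ J → a < b → b < c → F (insert a J) I → F (insert b (insert c J)) (insert i I) →
    F (insert c J) I → F (insert a (insert b J)) (insert i I) →
    (F (insert b J) I ↔ F (insert a (insert c J)) (insert i I))

/-- The property `F` holds for the sets of lines below the level `k`. -/
def LevelHolds (F : Finset (Fin n) → Finset (Fin n) → Prop) (u : WireState n) (k : ℕ) : Prop :=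
  F (u.lineSet WireColor.light k) (u.lineSet WireColor.dark k)

theorem levelHolds_cross_of_ne (F : Finset (Fin n) → Finset (Fin n) → Prop) (u : WireState n)
    (x : WireCrossing n) {k : ℕ} (hk : k ≠ x.height.val + 1) :
    LevelHolds F (u.cross x) k ↔ LevelHolds F u k := by
  rw [LevelHolds, LevelHolds, lineSet_cross_of_ne _ _ _ hk, lineSet_cross_of_ne _ _ _ hk]

variable {F : Finset (Fin n) → Finset (Fin n) → Prop}

theorem height_add_two_le (x : WireCrossing n) : x.height.val + 2 ≤ n := by
  have := x.height.isLt
  omega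

/-- With `i, i'` the upper and lower light lines and `j, j'` the lower and upper dark ones, crossing
only `x` shows `i, j` and crossing only `y` shows `i', j'`. The other four pairs of `dodgson` occur
at `u` or after both crossings. -/
theorem ExchangeClosed.far_aux (hF : ExchangeClosed F) (u : WireState n) (x y : WireCrossing n)
    (hx : x.color = WireColor.light) (hy : y.color = WireColor.dark) (hxy : x.height = y.height)
    (ux : Ascent u x) (uy : Ascent u y) (hu : ∀ k ≤ n, LevelHolds F u k)
    (hw : LevelHolds F ((u.cross x).cross y) (x.height.val + 1)) :
    LevelHolds F (u.cross x) (x.height.val + 1) ↔ LevelHolds F (u.cross y) (x.height.val + 1) := by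
  have hn := height_add_two_le x
  have hlow : y.lower = x.lower := by simp [WireCrossing.lower, hxy]
  have hupp : y.upper = x.upper := by simp [WireCrossing.upper, hxy]
  have h0 := hu x.height.val (by omega)
  have h1 := hu (x.height.val + 1) (by omega)
  have h2 := hu (x.height.val + 2) hn
  have hxd : x.color ≠ WireColor.dark := by simp [hx]
  have hyl : y.color ≠ WireColor.light := by simp [hy]
  have hd (v : WireState n) : (v.cross y).lineSet WireColor.dark (x.height.val + 1) =
      insert (v.line WireColor.dark x.upper) (v.lineSet WireColor.dark x.height.val) := by
    have := v.lineSet_cross_self hy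
    rwa [← hxy, hupp] at this
  have hlx : (u.cross x).line WireColor.dark x.upper = u.line WireColor.dark x.upper := by
    rw [line, cross_of_ne _ hxd, line]
  rw [LevelHolds, lineSet_cross_of_color_ne _ hyl, lineSet_cross_self _ hx, hd, hlx,
    lineSet_cross_of_color_ne _ hxd] at hw
  rw [LevelHolds, lineSet_height_succ, lineSet_height_succ] at h1
  rw [LevelHolds, lineSet_height_succ_succ, lineSet_height_succ_succ,
    Finset.insert_comm (u.line WireColor.dark x.upper)] at h2
  rw [LevelHolds, LevelHolds, lineSet_cross_of_color_ne _ hyl, lineSet_cross_self _ hx, hd,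
    lineSet_cross_of_color_ne _ hxd, lineSet_height_succ, lineSet_height_succ]
  have hnl (c : WireColor) : u.line c x.lower ∉ u.lineSet c x.height.val := by
    rw [line_mem_lineSet]; exact lt_irrefl _
  have hnu (c : WireColor) : u.line c x.upper ∉ u.lineSet c x.height.val := by
    rw [line_mem_lineSet]; exact Nat.not_succ_lt_self
  rw [Ascent, hx] at ux
  rw [Ascent, hy, hlow, hupp] at uy
  exact hF.dodgson ((card_lineSet _ _ (by omega)).trans (card_lineSet _ _ (by omega)).symm)
    (hnu _) (hnl _) (hnl _) (hnu _) (line_light_lt u ux) (line_dark_lt u uy) h2 h0 hw h1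

theorem Near.height_eq {x y : WireCrossing n} (h : Near x y) :
    y.height.val = x.height.val + 1 := (Fin.ext_iff.1 h.2).symm

/-- Let `a, b, c` be the three lines from bottom to top and `J` the lines below them. Both halves of
the hexagon show `a`, `ab`, `bc`, `c` added to `J`; only the half starting with `x` shows `b`, only
the other shows `ac`. The lines of the other colour stay fixed and give adjacent levels, as the flag
relation requires. -/
theorem ExchangeClosed.near_aux (hF : ExchangeClosed F) (u : WireState n) {x y : WireCrossing n}
    (h : Near x y) (ux : Ascent u x) (uy : Ascent u y) (hu : ∀ k ≤ n, LevelHolds F u k)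
    (hw : ∀ k ≤ n, LevelHolds F (((u.cross x).cross y).cross x) k) :
    LevelHolds F (u.cross x) (x.height.val + 1) ↔ LevelHolds F (u.cross y) (x.height.val + 2) := by
  have hn := height_add_two_le y
  have hh := h.height_eq
  obtain ⟨n1, n2, n3⟩ := h.lower_ne
  have h1 := hu (x.height.val + 1) (by omega)
  have h2 := hu (x.height.val + 2) (by omega)
  have w1 := hw (x.height.val + 1) (by omega)
  have w2 := hw (x.height.val + 2) (by omega)
  set c := x.color with hc
  have hyc : y.color = c := h.1.symm
  set p := x.height.val with hp
  have eu1 := lineSet_height_succ u x c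
  have eu2 := lineSet_height_succ_succ u x c
  have ex1 := lineSet_cross_self u (x := x) (c := c) rfl
  have ey2 : (u.cross y).lineSet c (p + 2) =
      insert (u.line c y.upper) (insert (u.line c x.lower) (u.lineSet c p)) := by
    rw [lineSet_height_succ_succ, lineSet_cross_of_ne _ _ _ (by omega), h.2, line_cross_lower _ hyc,
      line_cross_of_ne _ _ _ (by rwa [← h.2]) n2]
  have lw0 : (((u.cross x).cross y).cross x).line c x.lower = u.line c y.upper := by
    rw [line_cross_lower _ rfl, h.2, line_cross_lower _ hyc, line_cross_of_ne _ _ _ n2.symm n3.symm]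
  have lw1 : (((u.cross x).cross y).cross x).line c x.upper = u.line c x.upper := by
    rw [line_cross_upper _ rfl, line_cross_of_ne _ _ _ (by rwa [← h.2]) n2, line_cross_lower _ rfl]
  have sw : (((u.cross x).cross y).cross x).lineSet c p = u.lineSet c p := by
    rw [lineSet_cross_of_ne _ _ _ (by omega), lineSet_cross_of_ne _ _ _ (by omega),
      lineSet_cross_of_ne _ _ _ (by omega)]
  have ew1 := lineSet_height_succ (((u.cross x).cross y).cross x) x c
  have ew2 := lineSet_height_succ_succ (((u.cross x).cross y).cross x) x c
  rw [← hp, lw0, sw] at ew1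
  rw [← hp, lw0, lw1, sw] at ew2
  have ma : u.line c x.lower ∉ u.lineSet c p := by
    rw [line_mem_lineSet]; exact lt_irrefl _
  have mb : u.line c x.upper ∉ u.lineSet c p := by
    rw [line_mem_lineSet]; exact Nat.not_succ_lt_self
  have mc : u.line c y.upper ∉ u.lineSet c p := by
    rw [line_mem_lineSet]
    change ¬ (y.height.val + 1 < p)
    omega
  have hcard : ∀ d, (u.lineSet d (p + 1)).card = (u.lineSet c p).card + 1 := fun d => by
    rw [card_lineSet _ _ (by omega), card_lineSet _ _ (by omega)]
  have hi : ∀ d, u.line d x.upper ∉ u.lineSet d (p + 1) := fun d => by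
    rw [line_mem_lineSet]; exact lt_irrefl _
  have hother : ∀ d, c ≠ d → u.lineSet d (p + 2) = insert (u.line d x.upper)
      (u.lineSet d (p + 1)) := fun d _ => u.lineSet_succ d x.upper
  have hx' : ∀ d, c ≠ d → ∀ (v : WireState n) k, (v.cross x).lineSet d k = v.lineSet d k :=
    fun d hd v k => lineSet_cross_of_color_ne v hd k
  have hy' : ∀ d, c ≠ d → ∀ (v : WireState n) k, (v.cross y).lineSet d k = v.lineSet d k :=
    fun d hd v k => lineSet_cross_of_color_ne v (by rwa [hyc]) k
  rw [Ascent, ← hc] at ux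
  rw [Ascent, hyc, ← h.2] at uy
  clear_value c
  simp only [LevelHolds] at h1 h2 w1 w2 ⊢
  cases c
  · have hne : WireColor.dark ≠ WireColor.light := by simp
    rw [hx' _ hne, hy' _ hne, hx' _ hne, ew1] at w1
    rw [hx' _ hne, hy' _ hne, hx' _ hne, ew2, hother _ hne] at w2
    rw [eu1] at h1
    rw [eu2, hother _ hne, Finset.insert_comm] at h2
    rw [hx' _ hne, hy' _ hne, ex1, ey2, hother _ hne, Finset.insert_comm (u.line _ y.upper)]
    exact hF.flag_col (hcard _) (hi _) ma mb mc (line_dark_lt u ux) (line_dark_lt u uy) h1 w2 w1 h2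
  · have hne : WireColor.light ≠ WireColor.dark := by simp
    rw [hx' _ hne, hy' _ hne, hx' _ hne, ew1] at w1
    rw [hx' _ hne, hy' _ hne, hx' _ hne, ew2, hother _ hne, Finset.insert_comm] at w2
    rw [eu1] at h1
    rw [eu2, hother _ hne] at h2
    rw [hx' _ hne, hy' _ hne, ex1, ey2, hother _ hne]
    -- Light lines come in decreasing order, so the outer two exchange roles.
    exact hF.flag_row (hcard _) (hi _) mc mb ma (line_light_lt u uy) (line_light_lt u ux) w1 h2 h1
      w2

theorem ExchangeClosed.locallyClosed (hF : ExchangeClosed F) :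
    LocallyClosed fun u : WireState n => ∀ k ≤ n, LevelHolds F u k where
  far u x y h ux uy hu hux huxy k hk := by
    by_cases hky : k = y.height.val + 1
    · by_cases hxy : x.height = y.height
      · subst hky
        have hcol : x.color ≠ y.color := by
          rcases h with h | h
          · exact h
          · exact absurd (by simp [WireCrossing.lower, hxy]) h.1
        have a := hux _ hk
        have b := huxy _ hk
        cases hx : x.color <;> cases hy : y.color
        · exact absurd (hx.trans hy.symm) hcol
        · rw [h.cross_comm] at b
          exact (hF.far_aux u y x hy hx hxy.symm uy ux hu b).2 a
        · rw [← hxy] at a b ⊢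
          exact (hF.far_aux u x y hx hy hxy ux uy hu b).1 a
        · exact absurd (hx.trans hy.symm) hcol
      -- At different heights, crossing `x` afterwards does not touch level `k`, so the state after
      -- both crossings already shows this minor.
      · have b := huxy k hk
        rw [h.cross_comm, levelHolds_cross_of_ne] at b
        · exact b
        · intro h'
          exact hxy (Fin.ext (by omega))
    · exact (levelHolds_cross_of_ne F u y hky).2 (hu k hk)
  near u x y h ux uy hu hux huxy hw := by
    have hh := h.height_eq
    have hny := height_add_two_le y
    have h1 : ∀ k ≤ n, LevelHolds F (u.cross y) k := fun k hk => by
      by_cases hky : k = x.height.val + 2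
      · rw [hky]
        exact (hF.near_aux u h ux uy hu hw).1 (hux _ (by omega))
      · exact (levelHolds_cross_of_ne F u y (by omega)).2 (hu k hk)
    refine ⟨h1, fun k hk => ?_⟩
    by_cases hkx : k = x.height.val + 1
    · have := hw k hk
      rwa [h.braid, levelHolds_cross_of_ne _ _ _ (by omega)] at this
    · exact (levelHolds_cross_of_ne F _ x hkx).2 (h1 k hk)
  near' u x y h ux uy hu huy huyx hw := by
    have hh := h.height_eq
    have hny := height_add_two_le y
    rw [← h.braid] at hw
    have h1 : ∀ k ≤ n, LevelHolds F (u.cross x) k := fun k hk => by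
      by_cases hkx : k = x.height.val + 1
      · rw [hkx]
        exact (hF.near_aux u h ux uy hu hw).2 (huy _ (by omega))
      · exact (levelHolds_cross_of_ne F u x hkx).2 (hu k hk)
    refine ⟨h1, fun k hk => ?_⟩
    by_cases hky : k = x.height.val + 2
    · have := hw k hk
      rwa [levelHolds_cross_of_ne _ _ _ (by omega)] at this
    · exact (levelHolds_cross_of_ne F _ y (by omega)).2 (h1 k hk)

end WireState

-- Subtraction-free expressions in the chamber minors.

universe u

namespace DoubleWiringDiagram

variable {n : ℕ} (D : DoubleWiringDiagram n)

/-- Families, indexed by all fields, of rational functions that are given by one subtraction-free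
expression in the chamber minors. -/
def IsSubtractionFree
    (f : ∀ (K : Type u) [Field K], FractionRing (MvPolynomial (Fin n × Fin n) K)) : Prop :=
  ∃ P Q : MvPolynomial D.Chamber ℕ, ∀ (K : Type u) [Field K],
    MvPolynomial.aeval (D.chamberMinor (genericMatrix n K)) Q ≠ 0 ∧
      f K = MvPolynomial.aeval (D.chamberMinor (genericMatrix n K)) P /
        MvPolynomial.aeval (D.chamberMinor (genericMatrix n K)) Q

variable {D}
variable {f g h : ∀ (K : Type u) [Field K], FractionRing (MvPolynomial (Fin n × Fin n) K)}

theorem IsSubtractionFree.add (hf : D.IsSubtractionFree f) (hg : D.IsSubtractionFree g) :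
    D.IsSubtractionFree fun K _ => f K + g K := by
  obtain ⟨P, Q, hf⟩ := hf
  obtain ⟨P', Q', hg⟩ := hg
  refine ⟨P * Q' + Q * P', Q * Q', fun K _ => ?_⟩
  obtain ⟨h1, h2⟩ := hf K
  obtain ⟨h3, h4⟩ := hg K
  simp only [map_add, map_mul]
  exact ⟨mul_ne_zero h1 h3, by rw [h2, h4, div_add_div _ _ h1 h3]⟩

theorem IsSubtractionFree.mul (hf : D.IsSubtractionFree f) (hg : D.IsSubtractionFree g) :
    D.IsSubtractionFree fun K _ => f K * g K := by
  obtain ⟨P, Q, hf⟩ := hf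
  obtain ⟨P', Q', hg⟩ := hg
  refine ⟨P * P', Q * Q', fun K _ => ?_⟩
  obtain ⟨h1, h2⟩ := hf K
  obtain ⟨h3, h4⟩ := hg K
  simp only [map_mul]
  exact ⟨mul_ne_zero h1 h3, by rw [h2, h4, div_mul_div_comm]⟩

/-- Closure under division: the numerator of `g` enters the new denominator, and it does not vanish
because `g` does not. -/
theorem IsSubtractionFree.of_mul_eq (hf : D.IsSubtractionFree f) (hg : D.IsSubtractionFree g)
    (h0 : ∀ (K : Type u) [Field K], g K ≠ 0) (he : ∀ (K : Type u) [Field K], g K * h K = f K) :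
    D.IsSubtractionFree h := by
  obtain ⟨P, Q, hf⟩ := hf
  obtain ⟨P', Q', hg⟩ := hg
  refine ⟨P * Q', Q * P', fun K _ => ?_⟩
  obtain ⟨h1, h2⟩ := hf K
  obtain ⟨h3, h4⟩ := hg K
  have h5 := h0 K
  have h6 : MvPolynomial.aeval (D.chamberMinor (genericMatrix n K)) P' ≠ 0 := by
    intro h
    rw [h4, h, zero_div] at h5
    exact h5 rfl
  simp only [map_mul]
  refine ⟨mul_ne_zero h1 h6, ?_⟩
  rw [eq_div_of_mul_eq (a := h K) h5 ((mul_comm _ _).trans (he K)), h2, h4, div_div_div_eq]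

variable (D)

/-- The minor with rows `I` and columns `J` has a subtraction-free expression. -/
def MinorSubtractionFree (I J : Finset (Fin n)) : Prop :=
  D.IsSubtractionFree fun (K : Type u) _ => setMinor (genericMatrix n K) I J

variable {D}

/-- The two factors on the left determine each other by division, since generic minors of square
shape are nonzero. -/
theorem minorSubtractionFree_iff {A A' B B' C C' E E' H H' G G' : Finset (Fin n)}
    (hrel : ∀ (K : Type u) [Field K],
      setMinor (genericMatrix n K) A A' * setMinor (genericMatrix n K) B B' =
        setMinor (genericMatrix n K) C C' * setMinor (genericMatrix n K) E E' +
        setMinor (genericMatrix n K) H H' * setMinor (genericMatrix n K) G G')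
    (hA : A'.card = A.card) (hB : B'.card = B.card) (hC : MinorSubtractionFree.{u} D C C')
    (hE : MinorSubtractionFree.{u} D E E') (hH : MinorSubtractionFree.{u} D H H')
    (hG : MinorSubtractionFree.{u} D G G') :
    MinorSubtractionFree.{u} D A A' ↔ MinorSubtractionFree.{u} D B B' := by
  have hsum := (hC.mul hE).add (hH.mul hG)
  constructor <;> intro h0
  · exact hsum.of_mul_eq h0 (fun K _ => setMinor_genericMatrix_ne_zero hA) fun K _ => hrel K
  · exact hsum.of_mul_eq h0 (fun K _ => setMinor_genericMatrix_ne_zero hB) fun K _ => by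
      rw [mul_comm]; exact hrel K

theorem exchangeClosed_minorSubtractionFree :
    WireState.ExchangeClosed (MinorSubtractionFree.{u} D) where
  dodgson hIJ hi hi' hj hj' hii hjj h1 h2 h3 h4 :=
    minorSubtractionFree_iff
      (fun K _ => setMinor_dodgson (genericMatrix n K) hIJ hi hi' hj hj' hii hjj)
      (by rw [Finset.card_insert_of_notMem hi, Finset.card_insert_of_notMem hj, hIJ])
      (by rw [Finset.card_insert_of_notMem hi', Finset.card_insert_of_notMem hj', hIJ]) h1 h2 h3 h4
  flag_col hIJ hi ha hb hc hab hbc h1 h2 h3 h4 :=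
    minorSubtractionFree_iff
      (fun K _ => setMinor_flag (genericMatrix n K) hIJ hi ha hb hc hab hbc)
      (by rw [Finset.card_insert_of_notMem hb, hIJ])
      (by rw [Finset.card_insert_of_notMem hi, hIJ, card_insert_insert ha hc (hab.trans hbc).ne rfl])
      h1 h2 h3 h4
  flag_row hIJ hi ha hb hc hab hbc h1 h2 h3 h4 :=
    minorSubtractionFree_iff
      (fun K _ => by
        simpa only [setMinor_transpose] using
          setMinor_flag (genericMatrix n K).transpose hIJ hi ha hb hc hab hbc)
      (by rw [Finset.card_insert_of_notMem hb, hIJ])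
      (by rw [Finset.card_insert_of_notMem hi, hIJ, card_insert_insert ha hc (hab.trans hbc).ne rfl])
      h1 h2 h3 h4

theorem minorSubtractionFree_empty : MinorSubtractionFree.{u} D ∅ ∅ :=
  ⟨1, 1, fun K _ => by simp [setMinor_empty]⟩

theorem minorSubtractionFree_chamber (C : D.Chamber) :
    MinorSubtractionFree.{u} D (D.below WireColor.light C) (D.below WireColor.dark C) :=
  ⟨MvPolynomial.X C, 1, fun K _ => by simp [chamberMinor, matrixMinor_eq_setMinor]⟩

/-! ### The diagram as a maximal chain of ascents. -/

variable (D)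

/-- The state after the first `t` crossings. -/
def state (t : ℕ) : WireState n := (D.word.take t).foldl WireState.cross 1

theorem linesAfter_eq (c : WireColor) (w : List (WireCrossing n)) :
    linesAfter c w = initialLines n c * (w.foldl WireState.cross 1 : WireState n) c := by
  induction w using List.reverseRecOn with
  | nil => exact (mul_one _).symm
  | append_singleton w x ih =>
    rw [linesAfter, List.foldl_append, List.foldl_append, List.foldl_cons, List.foldl_cons,
      List.foldl_nil, List.foldl_nil, WireState.cross, ← linesAfter, ih]
    split_ifs
    · rw [mul_assoc]
    · rfl

theorem state_zero : D.state 0 = 1 := by simp [state]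

theorem state_succ (t : Fin D.word.length) :
    D.state (t.val + 1) = (D.state t).cross D.word[t] := by
  rw [state, List.take_succ_eq_append_getElem t.isLt, List.foldl_append]
  rfl

theorem below_eq (c : WireColor) (C : D.Chamber) :
    D.below c C = (D.state (D.start C)).lineSet c (D.level C) := by
  rw [below, linesAfter_eq, WireState.lineSet, state]

/-- The lines `i` and `j` of colour `c` cross at time `t`. -/
def CrossAt (c : WireColor) (i j : Fin n) (t : Fin D.word.length) : Prop :=
  D.word[t].color = c ∧
    s(D.state t c D.word[t].lower, D.state t c D.word[t].upper) = s(i, j)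

theorem existsUnique_crossAt (c : WireColor) {i j : Fin n} (h : i ≠ j) :
    ∃! t, D.CrossAt c i j t := by
  have := D.crosses_once c (initialLines n c i) (initialLines n c j)
    ((initialLines n c).injective.ne h)
  convert this using 4 with t
  rw [linesAfter_eq, ← Sym2.map_mk]
  exact and_congr_right fun _ => (Sym2.map.injective (initialLines n c).injective).eq_iff.symm

/-- The swapped heights are neighbours, so only their own order is reversed. -/
theorem swap_lt_swap_iff (x : WireCrossing n) {p q : Fin n}
    (h : s(x.lower, x.upper) ≠ s(p, q)) :
    Equiv.swap x.lower x.upper p < Equiv.swap x.lower x.upper q ↔ p < q := by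
  simp only [ne_eq, Sym2.eq_iff, not_or, not_and] at h
  obtain ⟨c, k, hk⟩ := x
  simp only [Equiv.swap_apply_def, WireCrossing.lower, WireCrossing.upper, Fin.ext_iff,
    Fin.lt_def] at *
  split_ifs <;> (try dsimp only) <;> omega

/-- Two lines change their relative order only when they cross each other, which happens at `T`
alone. -/
theorem state_lt_iff (c : WireColor) {i j : Fin n} (hij : i < j) {T : Fin D.word.length}
    (hT : D.CrossAt c i j T) {t : ℕ} (ht : t ≤ D.word.length) :
    (D.state t c).symm i < (D.state t c).symm j ↔ t ≤ T.val := by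
  induction t with
  | zero => exact iff_of_true (by rw [state_zero]; exact hij) (Nat.zero_le _)
  | succ t ih =>
    have ih := ih (by omega)
    obtain ⟨s, rfl⟩ : ∃ s : Fin D.word.length, s.val = t := ⟨⟨t, ht⟩, rfl⟩
    rw [state_succ]
    by_cases hs : s = T
    · subst hs
      obtain ⟨hc, he⟩ := hT
      have hlt := ih.2 le_rfl
      have hsym (p : Fin n) : (((D.state s).cross D.word[s]) c).symm p =
          Equiv.swap D.word[s].lower D.word[s].upper ((D.state s c).symm p) := by
        rw [WireState.cross_of_eq _ hc]; rfl
      rw [hsym, hsym]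
      rcases Sym2.eq_iff.1 he with ⟨h1, h2⟩ | ⟨h1, h2⟩
      · rw [← h1, ← h2, Equiv.symm_apply_apply, Equiv.symm_apply_apply, Equiv.swap_apply_left,
          Equiv.swap_apply_right]
        have := WireState.lower_lt_upper D.word[s]
        constructor
        · intro h; exact absurd h this.not_gt
        · intro h; omega
      · rw [← h1, ← h2, Equiv.symm_apply_apply, Equiv.symm_apply_apply] at hlt
        exact absurd hlt (WireState.lower_lt_upper D.word[s]).not_gt
    · have hno : ¬ D.CrossAt c i j s := fun h =>
        hs ((D.existsUnique_crossAt c hij.ne).unique h hT)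
      have hiff : s.val + 1 ≤ T.val ↔ s.val ≤ T.val := by
        have : s.val ≠ T.val := fun h => hs (Fin.ext h)
        omega
      rw [hiff, ← ih]
      by_cases hc : D.word[s].color = c
      · have hsym (p : Fin n) : (((D.state s).cross D.word[s]) c).symm p =
            Equiv.swap D.word[s].lower D.word[s].upper ((D.state s c).symm p) := by
          rw [WireState.cross_of_eq _ hc]; rfl
        rw [hsym, hsym]
        refine swap_lt_swap_iff _ fun h => hno ⟨hc, ?_⟩
        have := congrArg (Sym2.map (D.state s c)) h
        simpa using this
      · rw [WireState.cross_of_ne _ hc]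

/-- Otherwise the two lines would already be reversed before their only crossing. -/
theorem ascent_state (t : Fin D.word.length) : (D.state t).Ascent D.word[t] := by
  have hlt := WireState.lower_lt_upper D.word[t]
  by_contra h
  have h' := lt_of_le_of_ne (not_lt.1 h) ((D.state t D.word[t].color).injective.ne hlt.ne')
  have := (D.state_lt_iff D.word[t].color h' ⟨rfl, Sym2.eq_swap⟩ t.isLt.le).2 le_rfl
  rw [Equiv.symm_apply_apply, Equiv.symm_apply_apply] at this
  exact hlt.not_gt this

theorem not_ascent_state_length (x : WireCrossing n) :
    ¬ (D.state D.word.length).Ascent x := by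
  intro h
  obtain ⟨T, hT, -⟩ := D.existsUnique_crossAt x.color h.ne
  have := (D.state_lt_iff x.color h hT le_rfl).1 (by
    rw [Equiv.symm_apply_apply, Equiv.symm_apply_apply]; exact WireState.lower_lt_upper x)
  exact absurd this (by have := T.isLt; omega)

theorem maximalPath_state {G : WireState n → Prop} (hG : ∀ t ≤ D.word.length, G (D.state t))
    {t : ℕ} (ht : t ≤ D.word.length) : WireState.MaximalPath G (D.state t) := by
  induction ht using Nat.decreasingInduction with
  | self => exact .last (hG _ le_rfl) D.not_ascent_state_length
  | of_succ t ht ih =>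
    refine .step D.word[t] (hG t ht.le) (D.ascent_state ⟨t, ht⟩) ?_
    rw [D.state_succ ⟨t, ht⟩] at ih
    exact ih

/-- At each level a state lies in a chamber: the one just opened by the last crossing, or the one it
was in before. Level `0` belongs to no chamber and needs `h0`. -/
theorem levelHolds_state {F : Finset (Fin n) → Finset (Fin n) → Prop} (h0 : F ∅ ∅)
    (hF : ∀ C : D.Chamber, F (D.below WireColor.light C) (D.below WireColor.dark C))
    {t : ℕ} (ht : t ≤ D.word.length) : ∀ k ≤ n, WireState.LevelHolds F (D.state t) k := by
  induction t with
  | zero =>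
    intro k hk
    obtain _ | k := k
    · have h (c : WireColor) : (D.state 0).lineSet c 0 = ∅ :=
        Finset.card_eq_zero.1 (WireState.card_lineSet _ _ hk)
      rwa [WireState.LevelHolds, h, h]
    · have := hF (Sum.inl ⟨k, hk⟩)
      rwa [below_eq, below_eq] at this
  | succ t ih =>
    intro k hk
    by_cases h : k = (D.word[t]).height.val + 1
    · have := hF (Sum.inr ⟨t, ht⟩)
      rw [below_eq, below_eq] at this
      rw [h]
      exact this
    · rw [D.state_succ ⟨t, ht⟩, WireState.levelHolds_cross_of_ne F _ D.word[(⟨t, ht⟩ : Fin _)] h]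
      exact ih (by omega) k hk

theorem exists_linesBelow_eq {k : ℕ} {I : Finset (Fin n)} (hI : I.card = k) :
    ∃ σ : Equiv.Perm (Fin n), linesBelow σ k = I := by
  have hk : k ≤ n := by rw [← hI]; simpa using Finset.card_le_univ I
  have hcard : (Finset.univ.filter fun p : Fin n => p.val < k).card = I.card := by
    rw [Fin.card_filter_val_lt, min_eq_right hk, hI]
  let e := Finset.equivOfCardEq hcard
  refine ⟨e.extendSubtype, Finset.eq_of_subset_of_card_le ?_ (by rw [card_linesBelow _ hk, hI])⟩
  intro i hi
  rw [linesBelow, Finset.mem_map] at hi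
  obtain ⟨p, hp, rfl⟩ := hi
  exact e.extendSubtype_mem p hp

theorem exists_state_lineSet_eq {k : ℕ} {I J : Finset (Fin n)} (hI : I.card = k)
    (hJ : J.card = k) : ∃ v : WireState n,
      v.lineSet WireColor.light k = I ∧ v.lineSet WireColor.dark k = J := by
  obtain ⟨σ, hσ⟩ := exists_linesBelow_eq hI
  obtain ⟨τ, hτ⟩ := exists_linesBelow_eq hJ
  -- The inverse undoes the passage from initial heights to line numbers in `lineSet`.
  refine ⟨fun c => (initialLines n c)⁻¹ * match c with
    | WireColor.light => σ
    | WireColor.dark => τ, ?_, ?_⟩ <;> simpa [WireState.lineSet]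

theorem minorSubtractionFree {k : ℕ} {I J : Finset (Fin n)} (hI : I.card = k)
    (hJ : J.card = k) : MinorSubtractionFree.{u} D I J := by
  obtain ⟨v, rfl, rfl⟩ := exists_state_lineSet_eq hI hJ
  have hpath := D.maximalPath_state (t := 0)
    (G := fun v => ∀ k ≤ n, v.LevelHolds (MinorSubtractionFree.{u} D) k)
    (fun t ht => D.levelHolds_state
      minorSubtractionFree_empty.{u} minorSubtractionFree_chamber ht) (Nat.zero_le _)
  rw [state_zero] at hpath
  refine exchangeClosed_minorSubtractionFree.locallyClosed.holds_of_reaches 1 v hpath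
    (WireState.reaches_of_one v) k ?_
  rw [← hI]; simpa using Finset.card_le_univ (v.lineSet WireColor.light k)

/-! ### Counting and distinguishing the chambers. -/

theorem length_word : D.word.length = 2 * n.choose 2 := by
  let f (b : Bool) : WireColor := if b then WireColor.dark else WireColor.light
  let e : Bool ≃ WireColor :=
    ⟨f, fun c => decide (c = WireColor.dark), fun b => by cases b <;> simp [f],
      fun c => by cases c <;> simp [f]⟩
  -- A crossing is sent to its colour and its unordered pair of lines; unique crossing is
  -- bijectivity of this map.
  let m (t : Fin D.word.length) : Bool × {a : Sym2 (Fin n) // ¬ a.IsDiag} :=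
    (e.symm D.word[t].color,
      ⟨s(D.state t D.word[t].color D.word[t].lower, D.state t D.word[t].color D.word[t].upper), by
        rw [Sym2.mk_isDiag_iff]
        exact (D.ascent_state t).ne⟩)
  have hm : Function.Bijective m := by
    rw [Function.bijective_iff_existsUnique]
    rintro ⟨b, ⟨a, ha⟩⟩
    induction a using Sym2.ind with
    | h i j =>
      rw [Sym2.mk_isDiag_iff] at ha
      refine (existsUnique_congr fun t => ?_).1 (D.existsUnique_crossAt (e b) ha)
      simp only [CrossAt, m, Prod.mk.injEq, Subtype.mk.injEq, Equiv.symm_apply_eq]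
      constructor <;> rintro ⟨h1, h2⟩ <;> refine ⟨h1, ?_⟩
      · rwa [h1]
      · rwa [h1] at h2
  have h := Fintype.card_of_bijective hm
  rwa [Fintype.card_fin, Fintype.card_prod, Fintype.card_bool, Sym2.card_subtype_not_diag,
    Fintype.card_fin] at h

theorem card_chamber : Fintype.card D.Chamber = n ^ 2 := by
  rw [Fintype.card_sum, Fintype.card_fin, Fintype.card_fin, length_word, Nat.choose_two_right,
    Nat.mul_div_cancel' (Nat.even_mul_pred_self n).two_dvd]
  obtain _ | n := n
  · rfl
  · rw [Nat.add_sub_cancel]; ring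

theorem eq_of_start_eq {C C' : D.Chamber} (hl : D.level C = D.level C')
    (hs : D.start C = D.start C') : C = C' := by
  rcases C with k | t <;> rcases C' with k' | t' <;> simp only [level, start] at hl hs
  · rw [Fin.ext (Nat.succ_injective hl)]
  · omega
  · omega
  · rw [Fin.ext (Nat.succ_injective hs)]

theorem start_le (C : D.Chamber) : D.start C ≤ D.word.length := by
  rcases C with k | t
  · exact Nat.zero_le _
  · exact t.isLt

/-- The crossing that opens `C'` brings its upper line below the chamber and its lower line out. At
the start of `C` these lines have not yet crossed, so the lower one is below whenever the upper one
is, and the sets differ. -/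
theorem not_start_lt {C C' : D.Chamber} (hl : D.level C = D.level C')
    (hb : ∀ c, D.below c C = D.below c C') : ¬ D.start C < D.start C' := by
  intro hlt
  rcases C' with k | t
  · exact absurd hlt (Nat.not_lt_zero _)
  have hle : D.start C ≤ t.val := Nat.lt_succ_iff.1 hlt
  set x := D.word[t] with hx
  have h := hb x.color
  rw [below_eq, below_eq, hl] at h
  change _ = WireState.lineSet (D.state (t.val + 1)) x.color (x.height.val + 1) at h
  change (D.state (D.start C)).lineSet x.color (x.height.val + 1) = _ at h
  rw [state_succ, WireState.lineSet_cross_self _ rfl] at h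
  have hasc := D.ascent_state t
  rw [← hx] at hasc
  have hord := (D.state_lt_iff x.color hasc ⟨rfl, rfl⟩ (D.start_le C)).2 hle
  set v := D.state (D.start C) with hv
  have hmem (p : Fin n) : v.line x.color ((v x.color).symm p) = initialLines n x.color p := by
    rw [WireState.line, Equiv.apply_symm_apply]
  have h1 : ((v x.color).symm (D.state t x.color x.upper)).val < x.height.val + 1 := by
    rw [← WireState.line_mem_lineSet, h, hmem]
    exact Finset.mem_insert_self _ _
  have h2 : ¬ ((v x.color).symm (D.state t x.color x.lower)).val < x.height.val + 1 := by
    rw [← WireState.line_mem_lineSet, h, hmem, Finset.mem_insert, not_or]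
    constructor
    · exact (initialLines n x.color).injective.ne hasc.ne
    · change (D.state t).line x.color x.lower ∉ _
      rw [WireState.line_mem_lineSet]
      exact lt_irrefl _
  exact h2 (lt_trans hord h1)

theorem below_injective :
    Function.Injective fun C : D.Chamber =>
      (D.below WireColor.light C, D.below WireColor.dark C) := by
  intro C C' h
  simp only [Prod.mk.injEq] at h
  have hb : ∀ c, D.below c C = D.below c C' := fun c => by
    cases c
    · exact h.2
    · exact h.1
  have hl : D.level C = D.level C' := by
    rw [← D.card_below WireColor.light, ← D.card_below WireColor.light C', h.1]
  exact D.eq_of_start_eq hl (le_antisymm (not_lt.1 (D.not_start_lt hl.symm fun c => (hb c).symm))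
    (not_lt.1 (D.not_start_lt hl hb)))

end DoubleWiringDiagram

theorem mainTheorem3 (n : ℕ) (D : DoubleWiringDiagram n) :
    (Fintype.card D.Chamber = n ^ 2 ∧
      Function.Injective fun C : D.Chamber => (D.below WireColor.light C, D.below WireColor.dark C)) ∧
    ∀ (k : ℕ) (I J : Finset (Fin n)) (hI : I.card = k) (hJ : J.card = k),
      ∃ P Q : MvPolynomial D.Chamber ℕ, ∀ (K : Type*) [Field K],
        MvPolynomial.aeval (D.chamberMinor (genericMatrix n K)) Q ≠ 0 ∧
        matrixMinor (genericMatrix n K) I J hI hJ =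
          MvPolynomial.aeval (D.chamberMinor (genericMatrix n K)) P /
            MvPolynomial.aeval (D.chamberMinor (genericMatrix n K)) Q := by
  refine ⟨⟨D.card_chamber, D.below_injective⟩, fun k I J hI hJ => ?_⟩
  obtain ⟨P, Q, h⟩ := D.minorSubtractionFree hI hJ
  refine ⟨P, Q, fun K _ => ?_⟩
  rw [matrixMinor_eq_setMinor]
  exact h K
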